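/- **Setting.** Let $\mu$ be a finite positive Borel measure on the unit circle $\mathbb T$ whose support is a closed arc $S=[a,b]$, running counterclockwise from $a$ to $b$ (for $a=b$ this means the whole circle, traversed once starting at $a$), and let $n\ge 2$. For arcs in general, $[c,d]$ and $(c,d)$ denote the closed and open counterclockwise arcs from $c$ to $d$ (for $c=d$: $\mathbb T$ and $\mathbb T\setminus\{c\}$). Put $\langle f,g\rangle=\int f\overline g\,d\mu$. Let $\rho_k$ be the monic orthogonal polynomial of degree $k$ for $\mu$, $\delta_k=\rho_k(0)$, and for a polynomial $P$ regarded as of degree at most $m$ let $P^*(z)=z^m\overline{P(1/\overline z)}$ (with $m=k$ for $P=\rho_k$). Put $$F_n(z)=\frac{z\rho_{n-1}(z)}{\rho_{n-1}^*(z)},\qquad \tau_a=F_n(a),\quad \tau_b=F_n(b),\qquad \varphi_c(z)=\frac{z+c}{1+\overline c z}.$$ For $\tau\in\mathbb T$, a $\tau$-invariant $(n,1)$-QPOPUC is a polynomial $Q$ of exact degree $n$ with $Q=\tau Q^*$ and $\langle Q,z^k\rangle=0$ for $1\le k\le n-1$. Let $\mathcal L_{2n-2}=\mathrm{span}\{z^k:|k|\le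 n-1\}$ and, for $\omega\in\mathbb T$, $\mathcal L_{2n-1}(\omega)=\mathcal L_{2n-2}\oplus\mathrm{span}\{z^n-\omega z^{-n}\}$. A *rule* is a quadrature formula $I_n(f)=\sum_{s=1}^n\lambda_s f(z_s)$ with distinct nodes $z_s\in S$ and weights $\lambda_s=\int L_s\,d\mu$, where for some $0\le p\le n-1$ the $L_s$ form the Lagrange basis for these nodes in $\mathrm{span}\{z^{-p},\dots,z^{n-1-p}\}$. It is *exact* in a space $V$ if $I_n(L)=\int L\,d\mu$ for all $L\in V$. Its *nodal polynomial* is $W_n(z)=\prod_{s=1}^n(z-z_s)$. A rule is a *Szegő formula* if all its weights are positive and it is exact in $\mathcal L_{2n-2}$; it is a *Szegő–Radau formula with prefixed node* $\alpha$ if in addition $\alpha$ is one of its nodes. **Theorem.** 1. Let $\omega\in\mathbb T$. A rule is a Szegő formula exact in $\mathcal L_{2n-1}(\omega)$ if and only if, for some $\tau\in\mathbb T$ with $-\tau\in[\tau_a,\tau_b]$, its nodal polynomial is a $\tau$-invariant $(n,1)$-QPOPUC and $\omega=\tau\varphi_{-\delta_n}(\tau)$. For given $\tau\in\mathbb T$,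 a Szegő formula whose nodal polynomial is a $\tau$-invariant $(n,1)$-QPOPUC exists if and only if $-\tau\in[\tau_a,\tau_b]$, and any two rules whose nodal polynomials are $\tau$-invariant $(n,1)$-QPOPUC coincide. If the nodal polynomial of a rule is a $\tau$-invariant $(n,1)$-QPOPUC, then all its nodes lie in $(a,b)$ if and only if $-\tau\in(\tau_a,\tau_b)$. 2. Let $\alpha\in(a,b)$. A rule is a Szegő–Radau formula with prefixed node $\alpha$ if and only if its nodal polynomial is a $\tau$-invariant $(n,1)$-QPOPUC with $$-\tau=\frac{\alpha\rho_{n-1}(\alpha)}{\rho_{n-1}^*(\alpha)}\quad\text{and}\quad -\tau\in[\tau_a,\tau_b].$$ There is at most one such formula, and one exists if and only if $F_n(\alpha)\in[\tau_a,\tau_b]$. If the nodal polynomial of a rule is a $\tau$-invariant $(n,1)$-QPOPUC for the above value of $\tau$, and $\omega=\tau\varphi_{-\delta_n}(\tau)$, then the rule is a Szegő–Radau formula with prefixed node $\alpha$ and is exact in $\mathcal L_{2n-1}(\omega)$. -/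

import Mathlib

open MeasureTheory

noncomputable section

namespace SzegoQuad

/-- The Borel σ-algebra of the unit circle. -/
instance instMeasurableSpaceCircle : MeasurableSpace Circle := borel Circle

instance instBorelSpaceCircle : BorelSpace Circle := ⟨rfl⟩

/-- The closed arc `[c, d]` of the unit circle, running counterclockwise from `c` to `d`.
For `c = d` it is the whole circle, traversed once starting at `c`. -/
def closedArc (c d : ℂ) : Set ℂ :=
  {z | ∃ u v θ : ℝ, u < v ∧ v ≤ u + 2 * Real.pi ∧
    c = Complex.exp (u * Complex.I) ∧ d = Complex.exp (v * Complex.I) ∧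
    u ≤ θ ∧ θ ≤ v ∧ z = Complex.exp (θ * Complex.I)}

/-- The open arc `(c, d)` of the unit circle, running counterclockwise from `c` to `d`.
For `c = d` it is the circle without the point `c`. -/
def openArc (c d : ℂ) : Set ℂ :=
  {z | ∃ u v θ : ℝ, u < v ∧ v ≤ u + 2 * Real.pi ∧
    c = Complex.exp (u * Complex.I) ∧ d = Complex.exp (v * Complex.I) ∧
    u < θ ∧ θ < v ∧ z = Complex.exp (θ * Complex.I)}

/-- The inner product of two polynomials in `L²(μ)`, linear in the first argument. -/
def ip (μ : Measure Circle) (P Q : Polynomial ℂ) : ℂ :=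
  ∫ z : Circle, P.eval (z : ℂ) * (starRingEnd ℂ) (Q.eval (z : ℂ)) ∂μ

/-- The monic orthogonal polynomial `ρ_n` of degree `n`, obtained from `1, z, z², …` by the
Gram-Schmidt process without normalization. -/
def rho (μ : Measure Circle) (n : ℕ) : Polynomial ℂ :=
  Polynomial.X ^ n - ∑ k : Fin n,
    Polynomial.C (ip μ (Polynomial.X ^ n) (rho μ k) / ip μ (rho μ k) (rho μ k)) * rho μ k
termination_by n
decreasing_by all_goals exact k.2

/-- The reversed polynomial `P^*(z) = z^n * conj (P (1 / conj z))` of a polynomial `P` of degree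
at most `n`: the coefficient of `z^k` is the conjugate of the coefficient of `z^(n-k)` in `P`. -/
def rev (n : ℕ) (P : Polynomial ℂ) : Polynomial ℂ :=
  Polynomial.reflect n (P.map (starRingEnd ℂ))

/-- The Schur parameter `δ_n = ρ_n(0)`. -/
def delta (μ : Measure Circle) (n : ℕ) : ℂ := (rho μ n).eval 0

/-- The Möbius transform `φ_a`. -/
def mobius (a z : ℂ) : ℂ := (z + a) / (1 + (starRingEnd ℂ) a * z)

/-- The Blaschke product `F_n(z) = z ρ_{n-1}(z) / ρ_{n-1}^*(z)` (for `n ≥ 1`). -/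
def blaschke (μ : Measure Circle) (n : ℕ) (z : ℂ) : ℂ :=
  z * (rho μ (n - 1)).eval z / (rev (n - 1) (rho μ (n - 1))).eval z

/-- `Q` is a `τ`-invariant quasi-paraorthogonal polynomial of degree `n` and order `2ℓ+1`:
it has exact degree `n`, satisfies `Q = τ Q^*`, and is orthogonal to `z^k` for
`ℓ + 1 ≤ k ≤ n - ℓ - 1`, that is, to the span of these powers. -/
structure IsQPOPUC (μ : Measure Circle) (n l : ℕ) (τ : Circle) (Q : Polynomial ℂ) : Prop where
  degree_eq : Q.degree = n
  invariant : Q = Polynomial.C (τ : ℂ) * rev n Q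
  orthogonal : ∀ k : ℕ, l + 1 ≤ k → k + l + 1 ≤ n → ip μ Q (Polynomial.X ^ k) = 0

/-- The space `𝕃_{p,q}` of Laurent polynomials spanned by `z^p, …, z^q`, as functions on the
unit circle. -/
def laurent (p q : ℤ) : Submodule ℂ (Circle → ℂ) :=
  Submodule.span ℂ ((fun (k : ℤ) (z : Circle) => (z : ℂ) ^ k) '' Set.Icc p q)

/-- The space `𝓛_{2k} = 𝕃_{-k,k}`. -/
def calLEven (k : ℕ) : Submodule ℂ (Circle → ℂ) := laurent (-(k : ℤ)) k

/-- The space `𝓛_{2k+1}(ω)`, spanned by `𝓛_{2k}` and `z^(k+1) - ω / z^(k+1)`. -/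
def calLOdd (k : ℕ) (ω : Circle) : Submodule ℂ (Circle → ℂ) :=
  calLEven k ⊔
    Submodule.span ℂ {fun z : Circle => (z : ℂ) ^ (k + 1) - (ω : ℂ) / (z : ℂ) ^ (k + 1)}

/-- The element of `𝕃_{-p,n-1-p}` that takes the value `1` at `node s` and vanishes at the other
nodes. -/
def lagrangeLaurent {n : ℕ} (node : Fin n → Circle) (p : ℕ) (s : Fin n) (z : Circle) : ℂ :=
  ((z : ℂ) / (node s : ℂ)) ^ (-(p : ℤ)) *
    ∏ j ∈ Finset.univ.erase s, ((z : ℂ) - node j) / ((node s : ℂ) - node j)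

/-- An interpolatory quadrature formula `I_n(f) = ∑ λ_s f(z_s)`: the nodes are distinct points of
the support of `μ`, and for some `0 ≤ p ≤ n - 1` the weights are the integrals of the
Lagrange basis of `𝕃_{-p,n-1-p}`. -/
structure Rule (μ : Measure Circle) (n : ℕ) where
  node : Fin n → Circle
  weight : Fin n → ℂ
  node_injective : Function.Injective node
  node_mem : ∀ s, node s ∈ μ.support
  interpolatory : ∃ p : ℕ, p + 1 ≤ n ∧
    ∀ s, weight s = ∫ z, lagrangeLaurent node p s z ∂μ

namespace Rule

variable {μ : Measure Circle} {n : ℕ}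

/-- The value `I_n(f)`. -/
def apply (R : Rule μ n) (f : Circle → ℂ) : ℂ := ∑ s, R.weight s * f (R.node s)

/-- The nodal polynomial. -/
def nodal (R : Rule μ n) : Polynomial ℂ :=
  ∏ s, (Polynomial.X - Polynomial.C (R.node s : ℂ))

/-- All weights are positive real numbers. -/
def Positive (R : Rule μ n) : Prop := ∀ s, ∃ r : ℝ, 0 < r ∧ R.weight s = r

/-- The formula integrates every element of `V` exactly. -/
def ExactOn (R : Rule μ n) (V : Submodule ℂ (Circle → ℂ)) : Prop :=
  ∀ L ∈ V, ∫ z, L z ∂μ = R.apply L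

/-- A Szegő formula: positive and exact in `𝓛_{2n-2}`. -/
def IsSzego (R : Rule μ n) : Prop := R.Positive ∧ R.ExactOn (calLEven (n - 1))

/-- A Szegő-Radau formula with prefixed node `α`. -/
def IsSzegoRadau (R : Rule μ n) (α : Circle) : Prop := R.IsSzego ∧ ∃ s, R.node s = α

end Rule

end SzegoQuad

end

open SzegoQuad

open SzegoQuad

namespace SzegoQuad

open Polynomial Complex

/-! Write W for the nodal polynomial. At the nodes `W z^{-k}` vanishes, so a rule integrates it
exactly if and only if W is orthogonal to `z^k`. Hence exactness in `𝓛_{2n-2}` amounts to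
orthogonality of W to `z, …, z^{n-1}` (`calLEven_le_of_orthogonal`). Positivity is then automatic,
the weights being squared norms of Lagrange basis polynomials, and so is `W = τ W^*` with `τ =
W(0)`, since all zeros lie on the circle. The monic polynomials of degree n with this orthogonality
are `z ρ_{n-1} + c ρ_{n-1}^*` (`eq_X_mul_rho_add`), so W is a `popuc`, whose zeros on the circle are
the solutions of `F_n = -τ`.

It remains to locate these solutions. The zeros of `ρ_{n-1}` lie in the open disc, so `F_n` is a
Blaschke product of degree n and its argument Ψ increases strictly, by 2πn per turn. Across the gap
from b to a it gains less than 2π (`phase_gap`): otherwise some paraorthogonal polynomial would have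
two zeros in the closed gap, and dividing them out would turn an orthogonality relation into the
integral of a nonzero function of constant sign on the support. So Ψ gains more than 2π(n-1) along
S, and exactly the values in `[τ_a, τ_b]` have all n preimages in S.

Finally, the error at `z^n` is `E = (τ - δ_n) ‖ρ_{n-1}‖²`. Exactness at `z^n - ω z^{-n}` says `E = ω
conj E`, which is the formula for ω. Prefixing a node α fixes `-τ = F_n(α)`. -/

theorem integrable_of_continuous {E : Type*} [NormedAddCommGroup E] (μ : Measure Circle)
    [IsFiniteMeasure μ] {f : Circle → E} (hf : Continuous f) : Integrable f μ :=
  hf.integrable_of_hasCompactSupport (HasCompactSupport.of_compactSpace f)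

theorem continuous_eval_coe (P : ℂ[X]) : Continuous fun z : Circle => P.eval (z : ℂ) :=
  P.continuous.comp continuous_induced_dom

theorem continuous_coe_zpow (k : ℤ) : Continuous fun z : Circle => (z : ℂ) ^ k :=
  continuous_induced_dom.zpow₀ k fun z => Or.inl z.coe_ne_zero

theorem conj_coe (z : Circle) : (starRingEnd ℂ) (z : ℂ) = (z : ℂ)⁻¹ := by
  rw [← Circle.coe_inv_eq_conj, Circle.coe_inv]

theorem eval_rev {n : ℕ} {P : ℂ[X]} (hP : P.natDegree ≤ n) (z : Circle) :
    (rev n P).eval (z : ℂ) = (z : ℂ) ^ n * (starRingEnd ℂ) (P.eval (z : ℂ)) := by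
  have hz : ((z : ℂ)⁻¹) ≠ 0 := inv_ne_zero z.coe_ne_zero
  let _ : Invertible ((z : ℂ)⁻¹) := invertibleOfNonzero hz
  have h := eval₂_reflect_mul_pow (RingHom.id ℂ) ((z : ℂ)⁻¹) n (P.map (starRingEnd ℂ))
    (natDegree_map_le.trans hP)
  rw [invOf_eq_inv, inv_inv] at h
  have h2 : eval₂ (RingHom.id ℂ) ((z : ℂ)⁻¹) (P.map (starRingEnd ℂ)) =
      (starRingEnd ℂ) (P.eval (z : ℂ)) := by
    rw [← conj_coe]
    exact eval_map_apply _ _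
  rw [h2] at h
  rw [← h, rev]
  have : (z : ℂ) ^ n * ((z : ℂ)⁻¹) ^ n = 1 := by
    rw [← mul_pow, mul_inv_cancel₀ z.coe_ne_zero, one_pow]
  change eval₂ (RingHom.id ℂ) _ _ = _
  linear_combination (-(eval₂ (RingHom.id ℂ) (z : ℂ) (reflect n (P.map (starRingEnd ℂ))))) * this

theorem coeff_rev {n k : ℕ} (hk : k ≤ n) (P : ℂ[X]) :
    (rev n P).coeff k = (starRingEnd ℂ) (P.coeff (n - k)) := by
  rw [rev, coeff_reflect, revAt_le hk, coeff_map]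

theorem natDegree_rev_le {n : ℕ} {P : ℂ[X]} (hP : P.natDegree ≤ n) :
    (rev n P).natDegree ≤ n := by
  rw [natDegree_le_iff_coeff_eq_zero]
  intro k hk
  rw [rev, coeff_reflect, revAt_eq_self_of_lt hk, coeff_map,
    coeff_eq_zero_of_natDegree_lt (hP.trans_lt hk), map_zero]

/-! ### The inner product of polynomials -/

section InnerProduct

variable (μ : Measure Circle) [IsFiniteMeasure μ]

theorem continuous_ip_integrand (P Q : ℂ[X]) :
    Continuous fun z : Circle => P.eval (z : ℂ) * (starRingEnd ℂ) (Q.eval (z : ℂ)) :=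
  (continuous_eval_coe P).mul (continuous_conj.comp (continuous_eval_coe Q))

/-- The inner product with `Q` as a linear functional. -/
noncomputable def ipLeft (Q : ℂ[X]) : ℂ[X] →ₗ[ℂ] ℂ where
  toFun P := ip μ P Q
  map_add' P P' := by
    unfold ip
    rw [← integral_add (integrable_of_continuous μ (continuous_ip_integrand P Q))
      (integrable_of_continuous μ (continuous_ip_integrand P' Q))]
    simp only [eval_add, add_mul]
  map_smul' c P := by
    unfold ip
    rw [RingHom.id_apply, smul_eq_mul, ← integral_const_mul]
    simp only [eval_smul, smul_eq_mul, mul_assoc]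

theorem ipLeft_apply (P Q : ℂ[X]) : ipLeft μ Q P = ip μ P Q := rfl

theorem ip_add_left (P P' Q : ℂ[X]) : ip μ (P + P') Q = ip μ P Q + ip μ P' Q :=
  (ipLeft μ Q).map_add P P'

theorem ip_sub_left (P P' Q : ℂ[X]) : ip μ (P - P') Q = ip μ P Q - ip μ P' Q :=
  (ipLeft μ Q).map_sub P P'

theorem ip_C_mul_left (c : ℂ) (P Q : ℂ[X]) : ip μ (C c * P) Q = c * ip μ P Q := by
  rw [← smul_eq_C_mul]
  exact (ipLeft μ Q).map_smul c P

omit [IsFiniteMeasure μ] in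
theorem conj_ip (P Q : ℂ[X]) : (starRingEnd ℂ) (ip μ P Q) = ip μ Q P := by
  unfold ip
  rw [← integral_conj]
  simp only [map_mul, conj_conj, mul_comm]

omit [IsFiniteMeasure μ] in
theorem ip_X_mul_X_mul (P Q : ℂ[X]) : ip μ (X * P) (X * Q) = ip μ P Q := by
  unfold ip
  refine integral_congr_ae (Filter.Eventually.of_forall fun z => ?_)
  simp only [eval_mul, eval_X, map_mul, conj_coe]
  field_simp [z.coe_ne_zero]

omit [IsFiniteMeasure μ] in
theorem ip_rev_X_pow {m k : ℕ} {P : ℂ[X]} (hP : P.natDegree ≤ m) (hk : k ≤ m) :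
    ip μ (rev m P) (X ^ k) = (starRingEnd ℂ) (ip μ P (X ^ (m - k))) := by
  rw [conj_ip]
  unfold ip
  refine integral_congr_ae (Filter.Eventually.of_forall fun z => ?_)
  have : (z : ℂ) ^ m = (z : ℂ) ^ (m - k) * (z : ℂ) ^ k := by rw [← pow_add]; congr 1; omega
  have h2 : (z : ℂ) ^ k * ((z : ℂ)⁻¹) ^ k = 1 := by
    rw [← mul_pow, mul_inv_cancel₀ z.coe_ne_zero, one_pow]
  simp only [eval_rev hP, eval_pow, eval_X, map_pow, conj_coe, this]
  linear_combination ((z : ℂ) ^ (m - k) * (starRingEnd ℂ) (eval (z : ℂ) P)) * h2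

theorem ip_eq_zero_of_coeff {P Q : ℂ[X]} (h : ∀ k, Q.coeff k ≠ 0 → ip μ P (X ^ k) = 0) :
    ip μ P Q = 0 := by
  rw [← conj_ip, ← ipLeft_apply, Q.as_sum_support_C_mul_X_pow, map_sum,
    Finset.sum_eq_zero, map_zero]
  intro k hk
  rw [ipLeft_apply, ip_C_mul_left, ← conj_ip, h k (mem_support_iff.1 hk), map_zero, mul_zero]

/-- The support carries all the mass, so the sign matters only there; near a support point with `g ≠
0` the continuous `g` is nonzero on an open set of positive measure. -/
theorem integral_pos_of_support {g : Circle → ℝ} (hg : Continuous g)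
    (h0 : ∀ z ∈ μ.support, 0 ≤ g z) (h1 : ∃ z ∈ μ.support, g z ≠ 0) : 0 < ∫ z, g z ∂μ := by
  have hae : 0 ≤ᵐ[μ] g := by
    filter_upwards [Measure.support_mem_ae (μ := μ)] with z hz using h0 z hz
  rw [integral_pos_iff_support_of_nonneg_ae hae (integrable_of_continuous μ hg)]
  obtain ⟨z, hz, hgz⟩ := h1
  exact (Measure.mem_support_iff_forall z).1 hz _ (hg.isOpen_support.mem_nhds hgz)

theorem exists_mem_support_eval_ne_zero {μ : Measure Circle} (hμ : μ.support.Infinite)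
    {P : ℂ[X]} (hP : P ≠ 0) : ∃ z ∈ μ.support, P.eval (z : ℂ) ≠ 0 := by
  by_contra! h
  refine (hμ.image Circle.coe_injective.injOn) ((P.rootSet_finite ℂ).subset ?_)
  rintro _ ⟨z, hz, rfl⟩
  rw [mem_rootSet]
  exact ⟨hP, by simpa using h z hz⟩

omit [IsFiniteMeasure μ] in
theorem ip_self (P : ℂ[X]) : ip μ P P = ((∫ z : Circle, ‖P.eval (z : ℂ)‖ ^ 2 ∂μ : ℝ) : ℂ) := by
  unfold ip
  rw [← integral_complex_ofReal]
  refine integral_congr_ae (Filter.Eventually.of_forall fun z => ?_)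
  simp [mul_conj, normSq_eq_norm_sq]

theorem integral_norm_sq_pos {μ : Measure Circle} [IsFiniteMeasure μ] (hμ : μ.support.Infinite)
    {P : ℂ[X]} (hP : P ≠ 0) : 0 < ∫ z : Circle, ‖P.eval (z : ℂ)‖ ^ 2 ∂μ := by
  obtain ⟨z, hz, h⟩ := exists_mem_support_eval_ne_zero hμ hP
  exact integral_pos_of_support μ ((continuous_eval_coe P).norm.pow 2)
    (fun _ _ => by positivity) ⟨z, hz, by simpa using h⟩

theorem ip_self_eq_zero {μ : Measure Circle} [IsFiniteMeasure μ] (hμ : μ.support.Infinite)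
    {P : ℂ[X]} : ip μ P P = 0 ↔ P = 0 := by
  refine ⟨fun h => ?_, fun h => by simp [h, ip]⟩
  by_contra hP
  rw [ip_self, ofReal_eq_zero] at h
  exact (integral_norm_sq_pos hμ hP).ne' h

end InnerProduct

/-! ### Orthogonal polynomials, the Szegő recurrence and location of zeros -/

section OrthogonalPolynomials

variable (μ : Measure Circle)

theorem rho_monic_natDegree (n : ℕ) : (rho μ n).Monic ∧ (rho μ n).natDegree = n := by
  induction n using Nat.strong_induction_on with
  | _ n ih =>
    have hdeg : (∑ k : Fin n, C (ip μ (X ^ n) (rho μ k) / ip μ (rho μ k) (rho μ k)) *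
        rho μ k).degree < (n : WithBot ℕ) := by
      rw [← mem_degreeLT]
      refine Submodule.sum_mem _ fun k _ => ?_
      rw [mem_degreeLT]
      rw [← smul_eq_C_mul]
      refine (degree_smul_le _ _).trans_lt ?_
      refine degree_le_natDegree.trans_lt ?_
      rw [(ih k k.2).2]
      exact_mod_cast k.2
    rw [rho]
    refine ⟨monic_X_pow_sub hdeg, ?_⟩
    rw [natDegree_eq_of_degree_eq_some]
    rw [degree_sub_eq_left_of_degree_lt (by rwa [degree_X_pow]), degree_X_pow]

theorem rho_monic (n : ℕ) : (rho μ n).Monic := (rho_monic_natDegree μ n).1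

theorem natDegree_rho (n : ℕ) : (rho μ n).natDegree = n := (rho_monic_natDegree μ n).2

variable {μ} [IsFiniteMeasure μ] (hμ : μ.support.Infinite)

include hμ

theorem ip_rho_rho {k n : ℕ} (hk : k < n) : ip μ (rho μ n) (rho μ k) = 0 := by
  induction n using Nat.strong_induction_on generalizing k with
  | _ n ih =>
    rw [rho, ip_sub_left, ← ipLeft_apply μ (∑ k : Fin n, _), map_sum,
      Finset.sum_eq_single (⟨k, hk⟩ : Fin n), ipLeft_apply, ip_C_mul_left, div_mul_cancel₀, sub_self]
    · exact (ip_self_eq_zero hμ).not.2 (rho_monic μ k).ne_zero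
    · intro j _ hj
      rw [ipLeft_apply, ip_C_mul_left]
      rcases lt_trichotomy (j : ℕ) k with h | h | h
      · rw [← conj_ip μ (rho μ k), ih k hk h, map_zero, mul_zero]
      · exact absurd (Fin.ext h) hj
      · rw [ih j j.2 h, mul_zero]
    · simp

theorem ip_rho_of_degree_lt {n : ℕ} {Q : ℂ[X]} (hQ : Q.degree < n) : ip μ (rho μ n) Q = 0 := by
  suffices h : ∀ m ≤ n, ∀ Q : ℂ[X], Q.degree < m → ip μ (rho μ n) Q = 0 from h n le_rfl Q hQ
  intro m
  induction m with
  | zero =>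
    intro _ Q hQ
    have : Q = 0 := by simpa [Nat.WithBot.lt_zero_iff] using hQ
    simp [this, ip]
  | succ m ih =>
    intro hm Q hQ
    have hd : (Q - C (Q.coeff m) * rho μ m).degree < m := by
      rw [degree_lt_iff_coeff_zero]
      intro k hk
      rcases hk.eq_or_lt with rfl | hk
      · have := (rho_monic μ m).coeff_natDegree
        rw [natDegree_rho] at this
        simp [this]
      · rw [coeff_sub, coeff_C_mul, coeff_eq_zero_of_natDegree_lt (p := rho μ m)
          (by rw [natDegree_rho]; exact hk), (degree_lt_iff_coeff_zero Q (m + 1)).1 hQ k hk]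
        simp
    have h1 := ih (by omega) _ hd
    rw [← conj_ip, ip_sub_left, ip_C_mul_left, ← conj_ip μ (rho μ n) (rho μ m),
      ip_rho_rho hμ (by omega : m < n), map_zero, mul_zero, sub_zero, conj_ip] at h1
    exact h1

theorem ip_rho_X_pow {n k : ℕ} (hk : k < n) : ip μ (rho μ n) (X ^ k) = 0 :=
  ip_rho_of_degree_lt hμ (by rw [degree_X_pow]; exact_mod_cast hk)

/-- A monic polynomial of degree `m + 1` orthogonal to `z, …, z^m` is determined by its value at
`0`. -/
theorem eq_X_mul_rho_add {m : ℕ} {Q : ℂ[X]} (hQ : Q.Monic) (hdeg : Q.natDegree = m + 1)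
    (horth : ∀ k, 1 ≤ k → k ≤ m → ip μ Q (X ^ k) = 0) :
    Q = X * rho μ m + C (Q.coeff 0) * rev m (rho μ m) := by
  -- The two correction terms cancel the coefficients of `z^{m+1}` and `z^0`, so `D` lies in the
  -- span of `z, …, z^m`, to which it is also orthogonal.
  set D := Q - X * rho μ m - C (Q.coeff 0) * rev m (rho μ m) with hD
  have hrd := natDegree_rev_le (natDegree_rho μ m).le
  have hlead : (rho μ m).coeff m = 1 := by
    have := (rho_monic μ m).coeff_natDegree
    rwa [natDegree_rho] at this
  have hc0 : D.coeff 0 = 0 := by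
    rw [hD, coeff_sub, coeff_sub, coeff_C_mul, coeff_rev (Nat.zero_le m), Nat.sub_zero, hlead]
    simp
  have hck : ∀ k, m < k → D.coeff k = 0 := by
    intro k hk
    obtain ⟨j, rfl⟩ := Nat.exists_eq_succ_of_ne_zero (by omega : k ≠ 0)
    rw [hD, coeff_sub, coeff_sub, coeff_C_mul, Nat.succ_eq_add_one, coeff_X_mul,
      coeff_eq_zero_of_natDegree_lt (hrd.trans_lt hk)]
    rcases (by omega : m = j ∨ m < j) with rfl | hj
    · have := hQ.coeff_natDegree
      rw [hdeg] at this
      rw [this, hlead]; simp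
    · rw [coeff_eq_zero_of_natDegree_lt (by omega),
        coeff_eq_zero_of_natDegree_lt (by rw [natDegree_rho]; exact hj)]
      simp
  have hDk : ∀ k, 1 ≤ k → k ≤ m → ip μ D (X ^ k) = 0 := by
    intro k h1 h2
    rw [hD, ip_sub_left, ip_sub_left, ip_C_mul_left, horth k h1 h2,
      ip_rev_X_pow μ (natDegree_rho μ m).le h2, ip_rho_X_pow hμ (by omega)]
    obtain ⟨j, rfl⟩ := Nat.exists_eq_succ_of_ne_zero (by omega : k ≠ 0)
    rw [Nat.succ_eq_add_one, pow_succ', ip_X_mul_X_mul, ip_rho_X_pow hμ (by omega)]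
    simp
  have hDD : D = 0 := by
    rw [← ip_self_eq_zero hμ]
    refine ip_eq_zero_of_coeff μ fun k hk => hDk k ?_ ?_
    · rcases Nat.eq_zero_or_pos k with rfl | h
      · exact absurd hc0 hk
      · exact h
    · by_contra! h
      exact hk (hck k h)
  rw [hD, sub_sub, sub_eq_zero] at hDD
  exact hDD

/-- The Szegő recurrence. -/
theorem rho_succ (m : ℕ) :
    rho μ (m + 1) = X * rho μ m + C (delta μ (m + 1)) * rev m (rho μ m) := by
  have h := eq_X_mul_rho_add hμ (rho_monic μ (m + 1)) (natDegree_rho μ (m + 1))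
    (fun k _ hk => ip_rho_X_pow hμ (by omega))
  rwa [coeff_zero_eq_eval_zero] at h

theorem ip_rho_self (m : ℕ) : ip μ (rho μ m) (X ^ m) = ip μ (rho μ m) (rho μ m) := by
  have hd : (X ^ m - rho μ m).degree < (m : WithBot ℕ) := by
    have : (X ^ m : ℂ[X]).degree = (rho μ m).degree := by
      rw [degree_X_pow, degree_eq_natDegree (rho_monic μ m).ne_zero, natDegree_rho]
    have h := degree_sub_lt_left this (pow_ne_zero m X_ne_zero) (by
      rw [(rho_monic μ m).leadingCoeff, leadingCoeff_X_pow])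
    rwa [degree_X_pow] at h
  have h := ip_rho_of_degree_lt hμ hd
  rw [← conj_ip, ip_sub_left, map_sub, conj_ip, conj_ip, sub_eq_zero] at h
  exact h

theorem ip_rev_rho_one (m : ℕ) : ip μ (rev m (rho μ m)) 1 = ip μ (rho μ m) (rho μ m) := by
  have h := ip_rev_X_pow μ (natDegree_rho μ m).le (Nat.zero_le m)
  rw [pow_zero, Nat.sub_zero, ip_rho_self hμ, conj_ip] at h
  exact h

/-- This is `⟨ρ_{m+1}, 1⟩ = 0` expanded by the recurrence. -/
theorem ip_X_mul_rho_one (m : ℕ) :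
    ip μ (X * rho μ m) 1 = -delta μ (m + 1) * ip μ (rho μ m) (rho μ m) := by
  have h := ip_rho_X_pow hμ (Nat.succ_pos m)
  rw [pow_zero, Nat.succ_eq_add_one, rho_succ hμ, ip_add_left, ip_C_mul_left, ip_rev_rho_one hμ] at h
  linear_combination h

/-- The zeros of the orthogonal polynomials lie in the open unit disc. -/
theorem norm_lt_one_of_mem_roots_rho {m : ℕ} {r : ℂ} (hr : r ∈ (rho μ m).roots) : ‖r‖ < 1 := by
  have hne := (rho_monic μ m).ne_zero
  obtain ⟨q, hq⟩ := dvd_iff_isRoot.2 (isRoot_of_mem_roots hr)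
  have hq0 : q ≠ 0 := by rintro rfl; simp at hq; exact hne hq
  have hqd : q.degree < m := by
    have h := congrArg natDegree hq
    rw [natDegree_rho, natDegree_mul (X_sub_C_ne_zero r) hq0, natDegree_X_sub_C] at h
    rw [degree_eq_natDegree hq0]
    exact_mod_cast (by omega : q.natDegree < m)
  have h0 := ip_rho_of_degree_lt hμ hqd
  have h0' : ip μ q (rho μ m) = 0 := by rw [← conj_ip, h0, map_zero]
  -- Multiplication by `z` is an isometry and `ρ_m` is orthogonal to `q`, so Pythagoras gives `‖q‖²
  -- = ‖ρ_m‖² + |r|² ‖q‖²`, forcing `|r| < 1`.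
  have hX : X * q = rho μ m + C r * q := by rw [hq]; ring
  have h1 : ip μ q q = ip μ (rho μ m) (rho μ m) + r * (starRingEnd ℂ) r * ip μ q q := by
    conv_lhs => rw [← ip_X_mul_X_mul, hX]
    rw [ip_add_left, ip_C_mul_left, ← conj_ip μ _ (rho μ m), ← conj_ip μ _ q, ip_add_left,
      ip_C_mul_left, ip_add_left, ip_C_mul_left, h0, h0']
    simp only [map_add, map_mul, conj_ip, map_zero]
    ring
  rw [mul_conj, normSq_eq_norm_sq, ip_self, ip_self] at h1
  have h2 : (∫ z : Circle, ‖q.eval (z : ℂ)‖ ^ 2 ∂μ) =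
      (∫ z : Circle, ‖(rho μ m).eval (z : ℂ)‖ ^ 2 ∂μ) +
        ‖r‖ ^ 2 * ∫ z : Circle, ‖q.eval (z : ℂ)‖ ^ 2 ∂μ := by exact_mod_cast h1
  have h3 := integral_norm_sq_pos hμ hne
  have h4 := integral_norm_sq_pos hμ hq0
  by_contra! h
  nlinarith [mul_nonneg (by nlinarith : 0 ≤ ‖r‖ ^ 2 - 1) h4.le]

theorem eval_rho_ne_zero (m : ℕ) (z : Circle) : (rho μ m).eval (z : ℂ) ≠ 0 := by
  intro h
  have := norm_lt_one_of_mem_roots_rho hμ ((mem_roots (rho_monic μ m).ne_zero).2 h)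
  rw [Circle.norm_coe] at this
  exact lt_irrefl _ this

end OrthogonalPolynomials

/-! ### Arcs in terms of angles -/

section Arcs

theorem exists_circle_exp_mem_Ico (z : Circle) (u : ℝ) :
    ∃ θ, u ≤ θ ∧ θ < u + 2 * Real.pi ∧ Circle.exp θ = z := by
  have h := toIcoMod_mem_Ico Real.two_pi_pos u (arg z)
  refine ⟨toIcoMod Real.two_pi_pos u (arg z), h.1, h.2, ?_⟩
  rw [toIcoMod, zsmul_eq_mul, Circle.periodic_exp.sub_int_mul_eq, Circle.exp_arg]

theorem exists_arc_parameters (a b : Circle) : ∃ u v : ℝ, u < v ∧ v ≤ u + 2 * Real.pi ∧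
    Circle.exp u = a ∧ Circle.exp v = b := by
  obtain ⟨θ, h1, h2, h3⟩ := exists_circle_exp_mem_Ico b (arg a)
  -- Equality occurs when `a = b`; a full turn is then added so that the arc is the whole circle.
  rcases h1.eq_or_lt with h | h
  · refine ⟨arg a, θ + 2 * Real.pi, by linarith [Real.two_pi_pos], by linarith,
      Circle.exp_arg a, ?_⟩
    rw [Circle.periodic_exp, h3]
  · exact ⟨arg a, θ, h, h2.le, Circle.exp_arg a, h3⟩

theorem int_eq_zero_of_abs_mul_two_pi_lt {k : ℤ} (h1 : -(2 * Real.pi) < k * (2 * Real.pi))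
    (h2 : k * (2 * Real.pi) < 2 * Real.pi) : k = 0 := by
  have hp := Real.two_pi_pos
  have h3 : (-1 : ℝ) < k := by nlinarith
  have h4 : (k : ℝ) < 1 := by nlinarith
  have h5 : -1 < k := by exact_mod_cast h3
  have h6 : k < 1 := by exact_mod_cast h4
  omega

/-- Two lifts of the same arc differ by one common multiple of 2π, because both lengths lie in (0,
2π]. This makes membership in an arc, defined by some lift, decidable on any fixed lift. -/
theorem arc_lift {u v u' v' θ θ' : ℝ} (huv : u < v) (hv : v ≤ u + 2 * Real.pi)
    (hu : u ≤ θ) (hθ : θ < u + 2 * Real.pi) (huv' : u' < v') (hv' : v' ≤ u' + 2 * Real.pi)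
    (eu : Circle.exp u = Circle.exp u') (ev : Circle.exp v = Circle.exp v')
    (eθ : Circle.exp θ = Circle.exp θ') (h1 : u' ≤ θ') (h2 : θ' ≤ v') :
    θ ≤ v ∧ (u' < θ' → θ' < v' → u < θ ∧ θ < v) := by
  obtain ⟨k, hk⟩ := Circle.exp_eq_exp.1 eu
  obtain ⟨m, hm⟩ := Circle.exp_eq_exp.1 ev
  obtain ⟨j, hj⟩ := Circle.exp_eq_exp.1 eθ
  have hp := Real.two_pi_pos
  have hkm : m - k = 0 := by
    apply int_eq_zero_of_abs_mul_two_pi_lt <;> push_cast <;> linarith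
  have hkm' : (m : ℝ) = k := by exact_mod_cast sub_eq_zero.1 hkm
  rw [hkm'] at hm
  -- A point at the far end of a full circle is represented by `θ = u` on the other lift: inside the
  -- closed arc, outside the open one.
  rcases (by linarith : θ' + k * (2 * Real.pi) ≤ u + 2 * Real.pi).eq_or_lt with h | h
  · have hθv : θ' = v' := by linarith
    have hjk : j - k + 1 = 0 := by
      apply int_eq_zero_of_abs_mul_two_pi_lt <;> push_cast <;> linarith
    have hjk' : (j : ℝ) - k + 1 = 0 := by exact_mod_cast hjk
    have : (j : ℝ) = k - 1 := by linarith
    rw [this] at hj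
    exact ⟨by linarith, fun _ h' => absurd hθv h'.ne⟩
  · have hjk : j - k = 0 := by
      apply int_eq_zero_of_abs_mul_two_pi_lt <;> push_cast <;> linarith
    have hjk' : (j : ℝ) = k := by exact_mod_cast sub_eq_zero.1 hjk
    rw [hjk'] at hj
    exact ⟨by linarith, fun _ _ => ⟨by linarith, by linarith⟩⟩

theorem circle_exp_eq_of_coe {x y : ℝ} (h : (Circle.exp x : ℂ) = Complex.exp (y * I)) :
    Circle.exp x = Circle.exp y := Circle.ext h

theorem exp_mem_closedArc_iff {u v θ : ℝ} (huv : u < v) (hv : v ≤ u + 2 * Real.pi)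
    (hu : u ≤ θ) (hθ : θ < u + 2 * Real.pi) :
    (Circle.exp θ : ℂ) ∈ closedArc (Circle.exp u) (Circle.exp v) ↔ θ ≤ v := by
  constructor
  · rintro ⟨u', v', θ', huv', hv', eu, ev, h1, h2, eθ⟩
    exact (arc_lift huv hv hu hθ huv' hv' (circle_exp_eq_of_coe eu) (circle_exp_eq_of_coe ev)
      (circle_exp_eq_of_coe eθ) h1 h2).1
  · intro h
    exact ⟨u, v, θ, huv, hv, rfl, rfl, hu, h, rfl⟩

theorem exp_mem_openArc_iff {u v θ : ℝ} (huv : u < v) (hv : v ≤ u + 2 * Real.pi)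
    (hu : u ≤ θ) (hθ : θ < u + 2 * Real.pi) :
    (Circle.exp θ : ℂ) ∈ openArc (Circle.exp u) (Circle.exp v) ↔ u < θ ∧ θ < v := by
  constructor
  · rintro ⟨u', v', θ', huv', hv', eu, ev, h1, h2, eθ⟩
    exact (arc_lift huv hv hu hθ huv' hv' (circle_exp_eq_of_coe eu) (circle_exp_eq_of_coe ev)
      (circle_exp_eq_of_coe eθ) h1.le h2.le).2 h1 h2
  · rintro ⟨h1, h2⟩
    exact ⟨u, v, θ, huv, hv, rfl, rfl, h1, h2, rfl⟩

theorem infinite_closedArc (a b : Circle) :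
    {z : Circle | (z : ℂ) ∈ closedArc a b}.Infinite := by
  obtain ⟨u, v, huv, hv, rfl, rfl⟩ := exists_arc_parameters a b
  have hinj : Set.InjOn Circle.exp (Set.Ioo u v) := by
    intro x hx y hy hxy
    obtain ⟨k, hk⟩ := Circle.exp_eq_exp.1 hxy
    have : k = 0 := by
      apply int_eq_zero_of_abs_mul_two_pi_lt <;> linarith [hx.1, hx.2, hy.1, hy.2]
    rw [this] at hk
    simpa using hk
  refine ((Set.Ioo_infinite huv).image hinj).mono ?_
  rintro _ ⟨θ, hθ, rfl⟩
  exact (exp_mem_closedArc_iff huv hv hθ.1.le (by linarith [hθ.2])).2 hθ.2.le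

end Arcs

/-! ### Arguments of Blaschke products and counting preimages -/

section Phase

/-- `Ψ` is a continuous choice of the argument of `F`, a strictly increasing function along which
`F` winds `n` times around the circle. -/
structure IsPhase (F : ℂ → ℂ) (n : ℕ) (Ψ : ℝ → ℝ) : Prop where
  continuous : Continuous Ψ
  strictMono : StrictMono Ψ
  add_two_pi : ∀ θ, Ψ (θ + 2 * Real.pi) = Ψ θ + n * (2 * Real.pi)
  apply_exp : ∀ θ, F (Circle.exp θ) = Circle.exp (Ψ θ)

/-- A continuous choice of the argument of `(z - r) / (1 - conj r * z)` at `z = exp (θ * I)`. -/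
noncomputable def factorPhase (r : ℂ) (θ : ℝ) : ℝ :=
  θ + 2 * arg (1 - r * ((Circle.exp θ)⁻¹ : Circle))

theorem exp_two_mul_arg {w : ℂ} (hw : w ≠ 0) :
    (Circle.exp (2 * arg w) : ℂ) = w / (starRingEnd ℂ) w := by
  have h := norm_mul_exp_arg_mul_I w
  have hn : (‖w‖ : ℂ) ≠ 0 := by simpa using hw
  have hc : (starRingEnd ℂ) w = ‖w‖ * Complex.exp (-(arg w * I)) := by
    conv_lhs => rw [← h]
    rw [map_mul, conj_ofReal, ← exp_conj, map_mul, conj_ofReal, conj_I, mul_neg]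
  have h2 : w / (starRingEnd ℂ) w =
      (‖w‖ * Complex.exp (arg w * I)) / (‖w‖ * Complex.exp (-(arg w * I))) := by
    rw [← hc, h]
  rw [h2, mul_div_mul_left _ _ hn, ← Complex.exp_sub, Circle.coe_exp]
  congr 1
  push_cast
  ring

theorem re_one_sub_pos {r : ℂ} (hr : ‖r‖ < 1) (z : Circle) : 0 < (1 - r * z).re := by
  have h : (r * z).re ≤ ‖r‖ := by
    refine (re_le_norm _).trans ?_
    rw [norm_mul, Circle.norm_coe, mul_one]
  rw [sub_re, one_re]
  linarith

theorem one_sub_ne_zero {r : ℂ} (hr : ‖r‖ < 1) (z : Circle) : 1 - r * z ≠ 0 := by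
  intro h
  have := re_one_sub_pos hr z
  rw [h] at this
  simp at this

theorem sub_coe_ne_zero {r : ℂ} (hr : ‖r‖ < 1) (z : Circle) : (z : ℂ) - r ≠ 0 := by
  intro h
  rw [← sub_eq_zero.1 h, Circle.norm_coe] at hr
  exact lt_irrefl _ hr

/-- On the circle `z - r = z w` with `w = 1 - r z⁻¹`, so the quotient is `z · w / conj w`. As `w`
lies in the right half-plane, its principal argument is continuous. -/
theorem exp_factorPhase {r : ℂ} (hr : ‖r‖ < 1) (θ : ℝ) :
    (Circle.exp (factorPhase r θ) : ℂ) = ((Circle.exp θ : ℂ) - r) /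
      ((Circle.exp θ : ℂ) * (starRingEnd ℂ) ((Circle.exp θ : ℂ) - r)) := by
  rw [factorPhase, Circle.exp_add, Circle.coe_mul, exp_two_mul_arg (one_sub_ne_zero hr _)]
  generalize Circle.exp θ = z
  have hz := z.coe_ne_zero
  have h1 : (z : ℂ) - r = z * (1 - r * (z⁻¹ : Circle)) := by
    rw [Circle.coe_inv]; field_simp
  rw [h1, map_mul, conj_coe, mul_inv_cancel_left₀ hz, mul_div_assoc]

theorem continuous_factorPhase {r : ℂ} (hr : ‖r‖ < 1) : Continuous (factorPhase r) := by
  refine continuous_id.add (continuous_const.mul ?_)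
  rw [continuous_iff_continuousAt]
  intro θ
  refine ContinuousAt.comp (f := fun θ : ℝ => 1 - r * ((Circle.exp θ)⁻¹ : Circle))
    (continuousAt_arg (Or.inl (re_one_sub_pos hr _))) (Continuous.continuousAt ?_)
  exact continuous_const.sub (continuous_const.mul
    ((continuous_coe_zpow (-1)).comp Circle.exp.continuous |>.congr fun θ => by simp))

theorem factorPhase_add_int (r : ℂ) (θ : ℝ) (k : ℤ) :
    factorPhase r (θ + k * (2 * Real.pi)) = factorPhase r θ + k * (2 * Real.pi) := by
  have h : Circle.exp (θ + k * (2 * Real.pi)) = Circle.exp θ := Circle.periodic_exp.int_mul k θ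
  rw [factorPhase, h, factorPhase]
  ring

/-- No derivative is needed: the Möbius factor is injective on the circle, so its phase is
continuous and injective, hence monotone, and a full turn adds 2π, which excludes decrease. -/
theorem strictMono_factorPhase {r : ℂ} (hr : ‖r‖ < 1) : StrictMono (factorPhase r) := by
  have hinj : Function.Injective (factorPhase r) := by
    intro x y hxy
    have h := exp_factorPhase hr x
    rw [hxy, exp_factorPhase hr y] at h
    have hxy' : Circle.exp x = Circle.exp y := by
      generalize Circle.exp x = z at h
      generalize Circle.exp y = w at h
      have hz := sub_coe_ne_zero hr z
      have hw := sub_coe_ne_zero hr w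
      have hz' : (starRingEnd ℂ) ((z : ℂ) - r) ≠ 0 := (_root_.map_ne_zero _).2 hz
      have hw' : (starRingEnd ℂ) ((w : ℂ) - r) ≠ 0 := (_root_.map_ne_zero _).2 hw
      rw [div_eq_div_iff (mul_ne_zero w.coe_ne_zero hw') (mul_ne_zero z.coe_ne_zero hz'),
        map_sub, map_sub, conj_coe, conj_coe] at h
      have h0 : ((w : ℂ) - z) * (1 - r * (starRingEnd ℂ) r) = 0 := by
        have hzz := mul_inv_cancel₀ z.coe_ne_zero
        have hww := mul_inv_cancel₀ w.coe_ne_zero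
        linear_combination h - (w - r) * hzz + (z - r) * hww
      rcases mul_eq_zero.1 h0 with h0 | h0
      · exact Circle.ext (sub_eq_zero.1 h0).symm
      · rw [mul_conj, normSq_eq_norm_sq] at h0
        have : (1 : ℝ) - ‖r‖ ^ 2 = 0 := by exact_mod_cast h0
        nlinarith [norm_nonneg r]
    obtain ⟨k, hk⟩ := Circle.exp_eq_exp.1 hxy'
    rw [hk, factorPhase_add_int] at hxy
    linarith
  rcases (continuous_factorPhase hr).strictMono_of_inj hinj with h | h
  · exact h
  · have h1 := h (show (0 : ℝ) < 0 + (1 : ℤ) * (2 * Real.pi) by simp [Real.pi_pos])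
    rw [factorPhase_add_int] at h1
    simp only [Int.cast_one, one_mul] at h1
    linarith [Real.two_pi_pos]

theorem exists_isPhase_prod (s : Multiset ℂ) (hs : ∀ r ∈ s, ‖r‖ < 1) :
    ∃ Ψ, IsPhase (fun z => z * (s.map fun r => (z - r) / (z * (starRingEnd ℂ) (z - r))).prod)
      (s.card + 1) Ψ := by
  induction s using Multiset.induction_on with
  | empty =>
    exact ⟨id, continuous_id, strictMono_id, fun θ => by simp, fun θ => by simp⟩
  | cons r s ih =>
    obtain ⟨Ψ, h⟩ := ih fun r' hr' => hs r' (Multiset.mem_cons_of_mem hr')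
    have hr := hs r (Multiset.mem_cons_self r s)
    refine ⟨fun θ => Ψ θ + factorPhase r θ, h.continuous.add (continuous_factorPhase hr),
      h.strictMono.add (strictMono_factorPhase hr), fun θ => ?_, fun θ => ?_⟩
    · have := factorPhase_add_int r θ 1
      simp only [Int.cast_one, one_mul] at this
      rw [h.add_two_pi, this, Multiset.card_cons]
      push_cast
      ring
    · have := h.apply_exp θ
      rw [Circle.exp_add, Circle.coe_mul, ← this, exp_factorPhase hr, Multiset.map_cons,
        Multiset.prod_cons]
      ring

namespace IsPhase

variable {F : ℂ → ℂ} {n : ℕ} {Ψ : ℝ → ℝ} (h : IsPhase F n Ψ)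
include h

theorem exists_eq {u ψ : ℝ} (h1 : Ψ u ≤ ψ) (h2 : ψ < Ψ u + n * (2 * Real.pi)) :
    ∃ θ, u ≤ θ ∧ θ < u + 2 * Real.pi ∧ Ψ θ = ψ := by
  rw [← h.add_two_pi] at h2
  obtain ⟨θ, hθ, e⟩ := intermediate_value_Ico (by linarith [Real.two_pi_pos] : u ≤ u + 2 * Real.pi)
    h.continuous.continuousOn ⟨h1, h2⟩
  exact ⟨θ, hθ.1, hθ.2, e⟩

/-- `F` takes every value on the circle at `n` different points of the circle. -/
theorem exists_nodes (w : Circle) :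
    ∃ node : Fin n → Circle, Function.Injective node ∧ ∀ k, F (node k) = w := by
  obtain ⟨ψ, h1, h2, rfl⟩ := exists_circle_exp_mem_Ico w (Ψ 0)
  have hp := Real.two_pi_pos
  -- The value `w` corresponds to the n levels `ψ + 2πk`, `k < n`, all reached within one turn.
  have hex : ∀ k : Fin n, ∃ θ, 0 ≤ θ ∧ θ < 0 + 2 * Real.pi ∧ Ψ θ = ψ + (k : ℕ) * (2 * Real.pi) := by
    intro k
    refine h.exists_eq ?_ ?_
    · have : 0 ≤ ((k : ℕ) : ℝ) * (2 * Real.pi) := by positivity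
      linarith
    · have hk : ((k : ℕ) : ℝ) + 1 ≤ n := by exact_mod_cast k.2
      nlinarith
  choose θ hθ0 hθ1 hθ using hex
  refine ⟨fun k => Circle.exp (θ k), fun i j hij => ?_, fun k => ?_⟩
  · obtain ⟨m, hm⟩ := Circle.exp_eq_exp.1 hij
    have h0 : m = 0 := by
      apply int_eq_zero_of_abs_mul_two_pi_lt <;>
        linarith [hθ0 i, hθ1 i, hθ0 j, hθ1 j]
    have e : θ i = θ j := by rw [hm, h0]; simp
    have e2 : ((i : ℕ) : ℝ) * (2 * Real.pi) = (j : ℕ) * (2 * Real.pi) := by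
      linarith [hθ i, hθ j, congrArg Ψ e]
    exact Fin.ext (by exact_mod_cast mul_right_cancel₀ hp.ne' e2)
  · rw [h.apply_exp, hθ]
    congr 1
    exact_mod_cast Circle.periodic_exp.int_mul (k : ℕ) ψ

variable {u v : ℝ} (hn : 1 ≤ n) (huv : u < v) (hv : v ≤ u + 2 * Real.pi)
  (hgap : Ψ (u + 2 * Real.pi) < Ψ v + 2 * Real.pi)
include hv hgap

/-- Lowering `Ψ v` by n-1 turns yields a lift of the image arc with length in (0, 2π], as the arc
definitions require. The strict inequality is the gap condition. -/
theorem bounds : Ψ u < Ψ v - ((n : ℝ) - 1) * (2 * Real.pi) ∧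
    Ψ v - ((n : ℝ) - 1) * (2 * Real.pi) ≤ Ψ u + 2 * Real.pi ∧
    F (Circle.exp v) = Circle.exp (Ψ v - ((n : ℝ) - 1) * (2 * Real.pi)) := by
  have h1 := h.add_two_pi u
  have h2 := h.strictMono.monotone hv
  refine ⟨by linarith, by linarith, ?_⟩
  rw [h.apply_exp]
  congr 1
  have := Circle.periodic_exp.sub_int_mul_eq ((n : ℤ) - 1) (x := Ψ v)
  push_cast at this
  exact this.symm

include hn huv

theorem forall_mem_closedArc_iff (w : Circle) :
    (∀ z : Circle, F z = w → (z : ℂ) ∈ closedArc (Circle.exp u) (Circle.exp v)) ↔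
      (w : ℂ) ∈ closedArc (F (Circle.exp u)) (F (Circle.exp v)) := by
  obtain ⟨hU, hV, hFv⟩ := h.bounds hv hgap
  have hn' : (1 : ℝ) ≤ n := by exact_mod_cast hn
  have hp := Real.two_pi_pos
  obtain ⟨ψ, h1, h2, rfl⟩ := exists_circle_exp_mem_Ico w (Ψ u)
  rw [hFv, h.apply_exp, exp_mem_closedArc_iff hU hV h1 h2]
  constructor
  · intro H
    -- Only the last preimage in `[u, u + 2π)`, at level `n - 1`, has to be tested against `v`.
    obtain ⟨θ, t1, t2, t3⟩ := h.exists_eq (ψ := ψ + ((n : ℝ) - 1) * (2 * Real.pi))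
      (by nlinarith) (by linarith)
    have h3 := H (Circle.exp θ) (by
      rw [h.apply_exp, t3]
      congr 1
      have := Circle.periodic_exp.int_mul ((n : ℤ) - 1) ψ
      push_cast at this
      exact this)
    rw [exp_mem_closedArc_iff huv hv t1 t2] at h3
    have := h.strictMono.monotone h3
    linarith
  · intro H z hz
    obtain ⟨θ, t1, t2, rfl⟩ := exists_circle_exp_mem_Ico z u
    rw [exp_mem_closedArc_iff huv hv t1 t2, ← h.strictMono.le_iff_le]
    rw [h.apply_exp, Circle.coe_inj] at hz
    obtain ⟨k, hk⟩ := Circle.exp_eq_exp.1 hz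
    have h4 := h.strictMono t2
    rw [h.add_two_pi] at h4
    -- Within one turn the level is below `n`; integrality improves this to `k ≤ n - 1`.
    have hkn : (k : ℝ) < n := by nlinarith
    have hkn' : k + 1 ≤ (n : ℤ) := by exact_mod_cast hkn
    have hkn'' : (k : ℝ) + 1 ≤ n := by exact_mod_cast hkn'
    nlinarith

theorem forall_mem_openArc_iff (w : Circle) :
    (∀ z : Circle, F z = w → (z : ℂ) ∈ openArc (Circle.exp u) (Circle.exp v)) ↔
      (w : ℂ) ∈ openArc (F (Circle.exp u)) (F (Circle.exp v)) := by
  obtain ⟨hU, hV, hFv⟩ := h.bounds hv hgap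
  have hn' : (1 : ℝ) ≤ n := by exact_mod_cast hn
  have hp := Real.two_pi_pos
  obtain ⟨ψ, h1, h2, rfl⟩ := exists_circle_exp_mem_Ico w (Ψ u)
  rw [hFv, h.apply_exp, exp_mem_openArc_iff hU hV h1 h2]
  constructor
  · intro H
    obtain ⟨θ, t1, t2, t3⟩ := h.exists_eq (ψ := ψ + ((n : ℝ) - 1) * (2 * Real.pi))
      (by nlinarith) (by linarith)
    have h3 := H (Circle.exp θ) (by
      rw [h.apply_exp, t3]
      congr 1
      have := Circle.periodic_exp.int_mul ((n : ℤ) - 1) ψ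
      push_cast at this
      exact this)
    rw [exp_mem_openArc_iff huv hv t1 t2] at h3
    have h3' := h.strictMono h3.2
    -- The lowest level excludes the left endpoint, as the highest one excludes the right endpoint.
    obtain ⟨θ₀, s1, s2, s3⟩ := h.exists_eq (ψ := ψ) h1 (by nlinarith)
    have h4 := H (Circle.exp θ₀) (by rw [h.apply_exp, s3])
    rw [exp_mem_openArc_iff huv hv s1 s2] at h4
    have h4' := h.strictMono h4.1
    exact ⟨by linarith, by linarith⟩
  · intro H z hz
    obtain ⟨θ, t1, t2, rfl⟩ := exists_circle_exp_mem_Ico z u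
    rw [exp_mem_openArc_iff huv hv t1 t2, ← h.strictMono.lt_iff_lt (a := u),
      ← h.strictMono.lt_iff_lt (b := v)]
    rw [h.apply_exp, Circle.coe_inj] at hz
    obtain ⟨k, hk⟩ := Circle.exp_eq_exp.1 hz
    have h4 := h.strictMono t2
    have h5 := h.strictMono.monotone t1
    rw [h.add_two_pi] at h4
    have hkn : (k : ℝ) < n := by nlinarith
    have hkn' : k + 1 ≤ (n : ℤ) := by exact_mod_cast hkn
    have hkn'' : (k : ℝ) + 1 ≤ n := by exact_mod_cast hkn'
    have hk0 : (-1 : ℝ) < k := by nlinarith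
    have hk0' : 0 ≤ k := by
      have : -1 < k := by exact_mod_cast hk0
      omega
    have hk0'' : (0 : ℝ) ≤ k := by exact_mod_cast hk0'
    exact ⟨by nlinarith [H.1], by nlinarith [H.2]⟩

end IsPhase

end Phase

/-! ### Paraorthogonal polynomials and their zeros -/

/-- The paraorthogonal polynomial `z ρ_m(z) + τ ρ_m^*(z)`. -/
noncomputable def popuc (μ : Measure Circle) (m : ℕ) (τ : Circle) : ℂ[X] :=
  X * rho μ m + C (τ : ℂ) * rev m (rho μ m)

section

variable (μ : Measure Circle)

theorem popuc_monic_natDegree (m : ℕ) (τ : Circle) :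
    (popuc μ m τ).Monic ∧ (popuc μ m τ).natDegree = m + 1 := by
  have h1 : (X * rho μ m).Monic := monic_X.mul (rho_monic μ m)
  have h2 : (X * rho μ m).natDegree = m + 1 := by
    rw [natDegree_X_mul (rho_monic μ m).ne_zero, natDegree_rho]
  have h3 : (C (τ : ℂ) * rev m (rho μ m)).natDegree < (X * rho μ m).natDegree := by
    rw [h2]
    exact (natDegree_C_mul_le _ _).trans_lt
      (Nat.lt_succ_of_le (natDegree_rev_le (natDegree_rho μ m).le))
  refine ⟨h1.add_of_left (degree_lt_degree h3), ?_⟩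
  rw [popuc, natDegree_add_eq_left_of_natDegree_lt h3, h2]

theorem popuc_coeff_zero (m : ℕ) (τ : Circle) : (popuc μ m τ).coeff 0 = τ := by
  have hlead := (rho_monic μ m).coeff_natDegree
  rw [natDegree_rho] at hlead
  rw [popuc, coeff_add, coeff_C_mul, coeff_rev (Nat.zero_le m), Nat.sub_zero, hlead]
  simp

variable {μ} [IsFiniteMeasure μ] (hμ : μ.support.Infinite)
include hμ

theorem ip_popuc_X_pow {m k : ℕ} (τ : Circle) (h1 : 1 ≤ k) (h2 : k ≤ m) :
    ip μ (popuc μ m τ) (X ^ k) = 0 := by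
  obtain ⟨j, rfl⟩ := Nat.exists_eq_succ_of_ne_zero (by omega : k ≠ 0)
  rw [popuc, ip_add_left, ip_C_mul_left, ip_rev_X_pow μ (natDegree_rho μ m).le h2,
    ip_rho_X_pow hμ (by omega), Nat.succ_eq_add_one, pow_succ', ip_X_mul_X_mul,
    ip_rho_X_pow hμ (by omega)]
  simp

theorem ip_popuc_one (m : ℕ) (τ : Circle) :
    ip μ (popuc μ m τ) 1 = (τ - delta μ (m + 1)) * ip μ (rho μ m) (rho μ m) := by
  rw [popuc, ip_add_left, ip_C_mul_left, ip_X_mul_rho_one hμ, ip_rev_rho_one hμ]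
  ring

theorem eval_popuc_eq_zero_iff (m : ℕ) (τ z : Circle) :
    (popuc μ m τ).eval (z : ℂ) = 0 ↔ blaschke μ (m + 1) z = ((-τ : Circle) : ℂ) := by
  have hrev : (rev m (rho μ m)).eval (z : ℂ) ≠ 0 := by
    rw [eval_rev (natDegree_rho μ m).le]
    exact mul_ne_zero (pow_ne_zero _ z.coe_ne_zero)
      ((_root_.map_ne_zero _).2 (eval_rho_ne_zero hμ m z))
  rw [blaschke, Nat.add_sub_cancel, div_eq_iff hrev, popuc, eval_add, eval_mul, eval_mul, eval_X,
    eval_C, Circle.coe_neg, neg_mul, eq_neg_iff_add_eq_zero]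

omit [IsFiniteMeasure μ] hμ in
theorem blaschke_eq_prod (m : ℕ) (z : Circle) : blaschke μ (m + 1) z =
    z * ((rho μ m).roots.map fun r => ((z : ℂ) - r) / (z * (starRingEnd ℂ) (z - r))).prod := by
  have hev : (rho μ m).eval (z : ℂ) = ((rho μ m).roots.map fun r => (z : ℂ) - r).prod :=
    (IsAlgClosed.splits _).eval_eq_prod_roots_of_monic (rho_monic μ m) _
  have hcard : (rho μ m).roots.card = m := by
    rw [← (IsAlgClosed.splits (rho μ m)).natDegree_eq_card_roots, natDegree_rho]
  rw [blaschke, Nat.add_sub_cancel, eval_rev (natDegree_rho μ m).le, Multiset.prod_map_div,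
    Multiset.prod_map_mul, Multiset.map_const', Multiset.prod_replicate, hcard, hev,
    map_multiset_prod, Multiset.map_map, mul_div_assoc]
  rfl

theorem exists_isPhase_blaschke (m : ℕ) : ∃ Ψ, IsPhase (blaschke μ (m + 1)) (m + 1) Ψ := by
  obtain ⟨Ψ, h⟩ := exists_isPhase_prod (rho μ m).roots
    fun r hr => norm_lt_one_of_mem_roots_rho hμ hr
  have hcard : (rho μ m).roots.card = m := by
    rw [← (IsAlgClosed.splits (rho μ m)).natDegree_eq_card_roots, natDegree_rho]
  rw [hcard] at h
  exact ⟨Ψ, h.continuous, h.strictMono, h.add_two_pi, fun θ => by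
    rw [blaschke_eq_prod, ← h.apply_exp]⟩

/-- With `δ_{m+1} = τ` the recurrence would make `ρ_{m+1}` paraorthogonal, hence give it a zero on
the circle. This keeps the denominator of `φ_{-δ}(τ)` nonzero. -/
theorem delta_ne_coe (m : ℕ) (τ : Circle) : delta μ (m + 1) ≠ τ := by
  intro h
  obtain ⟨Ψ, hΨ⟩ := exists_isPhase_blaschke hμ m
  obtain ⟨node, _, hnode⟩ := hΨ.exists_nodes (-τ)
  have h1 := (eval_popuc_eq_zero_iff hμ m τ (node 0)).2 (hnode 0)
  rw [popuc, ← h, ← rho_succ hμ] at h1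
  exact eval_rho_ne_zero hμ _ _ h1

end

/-! ### The phase gains less than 2π across the gap -/

theorem sub_mul_sub_div (z : Circle) (α β : ℝ) :
    ((z : ℂ) - Circle.exp α) * (z - Circle.exp β) * (z : ℂ)⁻¹ =
      Circle.exp ((α + β) / 2) *
        ((2 * ((z * (Circle.exp ((α + β) / 2))⁻¹ : Circle) : ℂ).re -
          2 * Real.cos ((β - α) / 2) : ℝ) : ℂ) := by
  -- Centring at the midpoint of the two angles makes the expression real up to a constant
  -- unimodular factor.
  have hα : Circle.exp α = Circle.exp ((α + β) / 2) * (Circle.exp ((β - α) / 2))⁻¹ := by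
    rw [← Circle.exp_neg, ← Circle.exp_add]; congr 1; ring
  have hβ : Circle.exp β = Circle.exp ((α + β) / 2) * Circle.exp ((β - α) / 2) := by
    rw [← Circle.exp_add]; congr 1; ring
  have hcos : (2 : ℂ) * (Real.cos ((β - α) / 2) : ℂ) =
      Circle.exp ((β - α) / 2) + (Circle.exp ((β - α) / 2) : ℂ)⁻¹ := by
    rw [ofReal_cos, Complex.two_cos, ← Circle.coe_inv, ← Circle.exp_neg, Circle.coe_exp,
      Circle.coe_exp]
    push_cast
    rfl
  rw [hα, hβ]
  generalize Circle.exp ((α + β) / 2) = s at *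
  generalize Circle.exp ((β - α) / 2) = e at *
  have hre : (2 : ℂ) * (((z * s⁻¹ : Circle) : ℂ).re : ℂ) = z * (s : ℂ)⁻¹ + s * (z : ℂ)⁻¹ := by
    rw [re_eq_add_conj, conj_coe, Circle.coe_mul, Circle.coe_inv, mul_inv, inv_inv]
    ring
  rw [ofReal_sub, ofReal_mul, ofReal_mul, ofReal_ofNat, hcos, hre]
  push_cast
  have h1 := z.coe_ne_zero
  have h2 := s.coe_ne_zero
  have h3 := e.coe_ne_zero
  field_simp
  ring

/-- The difference of cosines is `-2` times a product of two sines of half-angles in [0, π]. -/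
theorem two_re_sub_two_cos_nonpos {u v β θ : ℝ} (hβ : v < β) (hβ' : β ≤ u + 2 * Real.pi)
    (h1 : u ≤ θ) (h2 : θ ≤ v) :
    2 * ((Circle.exp θ * (Circle.exp ((v + β) / 2))⁻¹ : Circle) : ℂ).re -
      2 * Real.cos ((β - v) / 2) ≤ 0 := by
  have hre : ((Circle.exp θ * (Circle.exp ((v + β) / 2))⁻¹ : Circle) : ℂ).re =
      Real.cos (θ - (v + β) / 2) := by
    rw [← div_eq_mul_inv, ← Circle.exp_sub, Circle.coe_exp, exp_ofReal_mul_I_re]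
  rw [hre, ← mul_sub, Real.cos_sub_cos]
  have e1 : (θ - (v + β) / 2 + (β - v) / 2) / 2 = -((v - θ) / 2) := by ring
  have e2 : (θ - (v + β) / 2 - (β - v) / 2) / 2 = -((β - θ) / 2) := by ring
  rw [e1, e2, Real.sin_neg, Real.sin_neg]
  have s1 : 0 ≤ Real.sin ((v - θ) / 2) :=
    Real.sin_nonneg_of_nonneg_of_le_pi (by linarith) (by linarith)
  have s2 : 0 ≤ Real.sin ((β - θ) / 2) :=
    Real.sin_nonneg_of_nonneg_of_le_pi (by linarith) (by linarith)
  nlinarith [mul_nonneg s1 s2]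

/-- The argument of the Blaschke product increases by less than `2π` along a gap of the support. -/
theorem phase_gap {μ : Measure Circle} [IsFiniteMeasure μ] {u v : ℝ} (huv : u < v)
    (hv : v ≤ u + 2 * Real.pi)
    (hμ : μ.support = {z : Circle | (z : ℂ) ∈ closedArc (Circle.exp u) (Circle.exp v)})
    {m : ℕ} {Ψ : ℝ → ℝ} (hΨ : IsPhase (blaschke μ (m + 1)) (m + 1) Ψ) :
    Ψ (u + 2 * Real.pi) < Ψ v + 2 * Real.pi := by
  have hinf : μ.support.Infinite := by rw [hμ]; exact infinite_closedArc _ _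
  by_contra! hcon
  obtain ⟨β, hβ, hΨβ⟩ := intermediate_value_Icc hv hΨ.continuous.continuousOn
    (⟨by linarith [Real.two_pi_pos], hcon⟩ : Ψ v + 2 * Real.pi ∈ Set.Icc _ _)
  have hvβ : v < β := by
    rw [← hΨ.strictMono.lt_iff_lt, hΨβ]
    linarith [Real.two_pi_pos]
  obtain ⟨τ, hτ⟩ : ∃ τ : Circle, -τ = Circle.exp (Ψ v) := ⟨-Circle.exp (Ψ v), neg_neg _⟩
  have hrv : (popuc μ m τ).IsRoot (Circle.exp v) :=
    (eval_popuc_eq_zero_iff hinf m τ _).2 (by rw [hΨ.apply_exp, hτ])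
  have hrβ : (popuc μ m τ).IsRoot (Circle.exp β) :=
    (eval_popuc_eq_zero_iff hinf m τ _).2 (by
      rw [hΨ.apply_exp, hτ, hΨβ, Circle.periodic_exp])
  have hne : (Circle.exp β : ℂ) - Circle.exp v ≠ 0 := by
    intro h
    obtain ⟨k, hk⟩ := Circle.exp_eq_exp.1 (Circle.ext (sub_eq_zero.1 h))
    have hk0 : k = 0 := by
      apply int_eq_zero_of_abs_mul_two_pi_lt <;> linarith [hβ.2, Real.two_pi_pos]
    rw [hk0] at hk
    simp at hk
    linarith
  obtain ⟨G₁, hG₁⟩ := dvd_iff_isRoot.2 hrv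
  have hrG : G₁.IsRoot (Circle.exp β) := by
    have h := hrβ
    rw [hG₁, IsRoot.def, eval_mul, eval_sub, eval_X, eval_C] at h
    exact (mul_eq_zero.1 h).resolve_left hne
  obtain ⟨G, rfl⟩ := dvd_iff_isRoot.2 hrG
  obtain ⟨hmon, hdeg⟩ := popuc_monic_natDegree μ m τ
  have hG0 : G ≠ 0 := by
    rintro rfl
    rw [mul_zero, mul_zero] at hG₁
    exact hmon.ne_zero hG₁
  have hGdeg : G.natDegree + 1 = m := by
    rw [hG₁, natDegree_mul (X_sub_C_ne_zero _) (mul_ne_zero (X_sub_C_ne_zero _) hG0),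
      natDegree_mul (X_sub_C_ne_zero _) hG0, natDegree_X_sub_C, natDegree_X_sub_C] at hdeg
    omega
  -- `X * G` has degree `m` and no constant term, so it lies in the span of `z, …, z^m`.
  have horth : ip μ (popuc μ m τ) (X * G) = 0 := by
    refine ip_eq_zero_of_coeff μ fun k hk => ?_
    rcases Nat.eq_zero_or_pos k with rfl | hk1
    · simp at hk
    · refine ip_popuc_X_pow hinf τ hk1 ?_
      have := le_natDegree_of_ne_zero hk
      rw [natDegree_X_mul hG0] at this
      omega
  set s := Circle.exp ((v + β) / 2) with hs
  set g : Circle → ℝ := fun z => -(2 * ((z * s⁻¹ : Circle) : ℂ).re -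
    2 * Real.cos ((β - v) / 2)) * ‖G.eval (z : ℂ)‖ ^ 2 with hg
  -- After the two zeros are split off, what remains is `|G|²` times a real factor that has constant
  -- sign on the support.
  have hpt : ∀ z : Circle, (popuc μ m τ).eval (z : ℂ) *
      (starRingEnd ℂ) ((X * G).eval (z : ℂ)) = -(s : ℂ) * (g z : ℂ) := by
    intro z
    have h := sub_mul_sub_div z v β
    have h2 : G.eval (z : ℂ) * (starRingEnd ℂ) (G.eval (z : ℂ)) =
        ((‖G.eval (z : ℂ)‖ ^ 2 : ℝ) : ℂ) := by rw [mul_conj, normSq_eq_norm_sq]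
    rw [hG₁, hg]
    simp only [eval_mul, eval_sub, eval_X, eval_C, map_mul, conj_coe]
    rw [ofReal_mul, ofReal_neg, ← h2]
    rw [← hs] at h
    linear_combination (eval (z : ℂ) G * (starRingEnd ℂ) (eval (z : ℂ) G)) * h
  have hint : ∫ z, g z ∂μ = 0 := by
    unfold ip at horth
    simp only [hpt] at horth
    rw [integral_const_mul, integral_complex_ofReal] at horth
    exact_mod_cast (mul_eq_zero.1 horth).resolve_left (neg_ne_zero.2 s.coe_ne_zero)
  have hgcont : Continuous g := by
    refine Continuous.mul (Continuous.neg (Continuous.sub (continuous_const.mul ?_)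
      continuous_const)) ((continuous_eval_coe G).norm.pow 2)
    have : Continuous fun z : Circle => ((z : ℂ) * (s⁻¹ : Circle)).re :=
      continuous_re.comp (continuous_induced_dom.mul continuous_const)
    exact this
  refine (integral_pos_of_support μ hgcont ?_ ?_).ne' hint
  · intro z hz
    rw [hμ] at hz
    obtain ⟨θ, h1, h2, rfl⟩ := exists_circle_exp_mem_Ico z u
    have h3 := (exp_mem_closedArc_iff huv hv h1 h2).1 hz
    exact mul_nonneg (neg_nonneg.2 (two_re_sub_two_cos_nonpos hvβ hβ.2 h1 h3)) (by positivity)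
  · obtain ⟨z, hz, hz0⟩ := exists_mem_support_eval_ne_zero hinf hmon.ne_zero
    refine ⟨z, hz, fun h0 => ?_⟩
    have h := hpt z
    rw [h0, ofReal_zero, mul_zero] at h
    rcases mul_eq_zero.1 h with h | h
    · exact hz0 h
    · rw [map_eq_zero, eval_mul, eval_X] at h
      have hGz := (mul_eq_zero.1 h).resolve_left z.coe_ne_zero
      exact hz0 (by rw [hG₁, eval_mul, eval_mul, hGz, mul_zero, mul_zero])

/-! ### When all zeros lie in the arc -/

section Arc

variable {μ : Measure Circle} [IsFiniteMeasure μ] {a b : Circle}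
  (hμ : μ.support = {z : Circle | (z : ℂ) ∈ closedArc a b})
include hμ

omit [IsFiniteMeasure μ] in
theorem infinite_support : μ.support.Infinite := by
  rw [hμ]
  exact infinite_closedArc a b

theorem forall_root_mem_closedArc_iff (m : ℕ) (τ : Circle) :
    (∀ z : Circle, (popuc μ m τ).eval (z : ℂ) = 0 → (z : ℂ) ∈ closedArc a b) ↔
      -(τ : ℂ) ∈ closedArc (blaschke μ (m + 1) a) (blaschke μ (m + 1) b) := by
  have hinf := infinite_support hμ
  obtain ⟨Ψ, hΨ⟩ := exists_isPhase_blaschke hinf m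
  obtain ⟨u, v, huv, hv, rfl, rfl⟩ := exists_arc_parameters a b
  simp only [eval_popuc_eq_zero_iff hinf]
  exact hΨ.forall_mem_closedArc_iff (Nat.succ_pos m) huv hv (phase_gap huv hv hμ hΨ) (-τ)

theorem forall_root_mem_openArc_iff (m : ℕ) (τ : Circle) :
    (∀ z : Circle, (popuc μ m τ).eval (z : ℂ) = 0 → (z : ℂ) ∈ openArc a b) ↔
      -(τ : ℂ) ∈ openArc (blaschke μ (m + 1) a) (blaschke μ (m + 1) b) := by
  have hinf := infinite_support hμ
  obtain ⟨Ψ, hΨ⟩ := exists_isPhase_blaschke hinf m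
  obtain ⟨u, v, huv, hv, rfl, rfl⟩ := exists_arc_parameters a b
  simp only [eval_popuc_eq_zero_iff hinf]
  exact hΨ.forall_mem_openArc_iff (Nat.succ_pos m) huv hv (phase_gap huv hv hμ hΨ) (-τ)

end Arc

theorem eval_mul_zpow_eq_sum {P : ℂ[X]} {n : ℕ} (hP : P.natDegree < n) (k : ℤ) (z : Circle) :
    P.eval (z : ℂ) * (z : ℂ) ^ k = ∑ i ∈ Finset.range n, P.coeff i * (z : ℂ) ^ ((i : ℤ) + k) := by
  rw [eval_eq_sum_range' hP, Finset.sum_mul]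
  refine Finset.sum_congr rfl fun i _ => ?_
  rw [zpow_add₀ z.coe_ne_zero, zpow_natCast, mul_assoc]

theorem natDegree_le_of_degree_lt_succ {P : ℂ[X]} {m : ℕ}
    (hP : P.degree < ((m + 1 : ℕ) : WithBot ℕ)) : P.natDegree ≤ m := by
  rw [natDegree_le_iff_coeff_eq_zero]
  exact fun k hk => (degree_lt_iff_coeff_zero P (m + 1)).1 hP k hk

/-! ### Nodal polynomials and the functions a rule integrates exactly -/

namespace Rule

section Nodal

variable {μ : Measure Circle} {n : ℕ} (R : Rule μ n)

theorem nodal_eq : R.nodal = Lagrange.nodal Finset.univ fun s => (R.node s : ℂ) := rfl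

theorem nodal_monic : R.nodal.Monic := Lagrange.nodal_monic

theorem natDegree_nodal : R.nodal.natDegree = n := by
  rw [nodal_eq, Lagrange.natDegree_nodal, Finset.card_univ, Fintype.card_fin]

theorem eval_nodal_eq_zero_iff (z : Circle) :
    R.nodal.eval (z : ℂ) = 0 ↔ ∃ s, R.node s = z := by
  rw [nodal_eq, Lagrange.eval_nodal, Finset.prod_eq_zero_iff]
  simp only [Finset.mem_univ, true_and, sub_eq_zero, Circle.coe_inj, eq_comm (a := z)]

theorem injOn_node : Set.InjOn (fun s => (R.node s : ℂ)) (Finset.univ : Finset (Fin n)) :=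
  (Circle.coe_injective.comp R.node_injective).injOn

theorem nodal_coeff_zero : R.nodal.coeff 0 = ((∏ s, -R.node s : Circle) : ℂ) := by
  have h : ((∏ s, -R.node s : Circle) : ℂ) = ∏ s, ((-R.node s : Circle) : ℂ) :=
    map_prod Circle.coeHom _ _
  rw [coeff_zero_eq_eval_zero, nodal_eq, Lagrange.eval_nodal, h]
  simp

theorem nodal_coeff_zero_ne_zero : R.nodal.coeff 0 ≠ 0 := by
  rw [nodal_coeff_zero]
  exact Circle.coe_ne_zero _

/-- Each factor `z - z_s` with `|z_s| = 1` equals `-z_s` times its own reversal; the identity is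
checked on the circle, an infinite set. -/
theorem nodal_eq_C_mul_rev : R.nodal = C (R.nodal.coeff 0) * rev n R.nodal := by
  have hinf : (Set.range ((↑) : Circle → ℂ)).Infinite := by
    have h := (infinite_closedArc 1 1).image Circle.coe_injective.injOn
    exact h.mono (Set.image_subset_range _ _)
  refine eq_of_infinite_eval_eq _ _ (hinf.mono ?_)
  rintro _ ⟨(z : Circle), rfl⟩
  have h : ((∏ s, -R.node s : Circle) : ℂ) = ∏ s, -(R.node s : ℂ) :=
    map_prod Circle.coeHom _ _
  have hz : (z : ℂ) ^ n = ∏ _s : Fin n, (z : ℂ) := by simp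
  change R.nodal.eval (z : ℂ) = (C (R.nodal.coeff 0) * rev n R.nodal).eval ((z : Circle) : ℂ)
  rw [eval_mul, eval_C, eval_rev R.natDegree_nodal.le, nodal_coeff_zero, h, nodal_eq,
    Lagrange.eval_nodal, map_prod, hz, ← Finset.prod_mul_distrib, ← Finset.prod_mul_distrib]
  refine Finset.prod_congr rfl fun s _ => ?_
  rw [map_sub, conj_coe, conj_coe]
  have h1 := z.coe_ne_zero
  have h2 := (R.node s).coe_ne_zero
  field_simp
  ring

theorem exists_isQPOPUC_of_orthogonal {m : ℕ} (R : Rule μ (m + 1))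
    (h : ∀ k, 1 ≤ k → k ≤ m → ip μ R.nodal (X ^ k) = 0) :
    ∃ τ, IsQPOPUC μ (m + 1) 0 τ R.nodal := by
  refine ⟨∏ s, -R.node s, ?_, ?_, fun k h1 h2 => h k (by omega) (by omega)⟩
  · rw [degree_eq_natDegree R.nodal_monic.ne_zero, R.natDegree_nodal]
  · rw [← nodal_coeff_zero]
    exact R.nodal_eq_C_mul_rev

theorem apply_add (f g : Circle → ℂ) : R.apply (f + g) = R.apply f + R.apply g := by
  simp only [apply, Pi.add_apply, mul_add, Finset.sum_add_distrib]

theorem apply_smul (c : ℂ) (f : Circle → ℂ) : R.apply (c • f) = c * R.apply f := by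
  simp only [apply, Pi.smul_apply, smul_eq_mul, Finset.mul_sum]
  exact Finset.sum_congr rfl fun _ _ => by ring

theorem apply_nodal_mul (f : Circle → ℂ) :
    R.apply (fun z => R.nodal.eval (z : ℂ) * f z) = 0 := by
  refine Finset.sum_eq_zero fun s _ => ?_
  change R.weight s * (R.nodal.eval (R.node s : ℂ) * f (R.node s)) = 0
  rw [(R.eval_nodal_eq_zero_iff (R.node s)).2 ⟨s, rfl⟩, zero_mul, mul_zero]

end Nodal

section Exact

variable {μ : Measure Circle} [IsFiniteMeasure μ] {n : ℕ} (R : Rule μ n)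

/-- The continuous functions that the rule integrates exactly. -/
noncomputable def exactSubmodule : Submodule ℂ (Circle → ℂ) where
  carrier := {f | Continuous f ∧ ∫ z, f z ∂μ = R.apply f}
  zero_mem' := ⟨continuous_const, by simp [apply]⟩
  add_mem' := by
    rintro f g ⟨hf, hf'⟩ ⟨hg, hg'⟩
    refine ⟨hf.add hg, ?_⟩
    rw [apply_add, ← hf', ← hg']
    exact integral_add (integrable_of_continuous μ hf) (integrable_of_continuous μ hg)
  smul_mem' := by
    rintro c f ⟨hf, hf'⟩
    refine ⟨hf.const_smul c, ?_⟩
    rw [apply_smul, ← hf', ← integral_const_mul]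
    rfl

theorem mem_exactSubmodule {f : Circle → ℂ} :
    f ∈ R.exactSubmodule ↔ Continuous f ∧ ∫ z, f z ∂μ = R.apply f := Iff.rfl

theorem exactOn_of_le {V : Submodule ℂ (Circle → ℂ)} (h : V ≤ R.exactSubmodule) :
    R.ExactOn V := fun _ hL => (h hL).2

theorem mon_mem_of_exactOn {k : ℕ} (h : R.ExactOn (calLEven k)) {j : ℤ} (h1 : -(k : ℤ) ≤ j)
    (h2 : j ≤ k) : (fun z : Circle => (z : ℂ) ^ j) ∈ R.exactSubmodule :=
  ⟨continuous_coe_zpow j, h _ (Submodule.subset_span ⟨j, ⟨h1, h2⟩, rfl⟩)⟩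

theorem calLEven_le_of_mon_mem {k : ℕ} (h : ∀ j : ℤ, -(k : ℤ) ≤ j → j ≤ k →
    (fun z : Circle => (z : ℂ) ^ j) ∈ R.exactSubmodule) : calLEven k ≤ R.exactSubmodule := by
  refine Submodule.span_le.2 ?_
  rintro _ ⟨j, ⟨h1, h2⟩, rfl⟩
  exact h j h1 h2

theorem eval_mul_zpow_mem {P : ℂ[X]} {N : ℕ} (hP : P.natDegree < N) (k : ℤ)
    (h : ∀ i : ℕ, i < N → (fun z : Circle => (z : ℂ) ^ ((i : ℤ) + k)) ∈ R.exactSubmodule) :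
    (fun z : Circle => P.eval (z : ℂ) * (z : ℂ) ^ k) ∈ R.exactSubmodule := by
  have e : (fun z : Circle => P.eval (z : ℂ) * (z : ℂ) ^ k) =
      ∑ i ∈ Finset.range N, P.coeff i • fun z : Circle => (z : ℂ) ^ ((i : ℤ) + k) := by
    ext z
    rw [eval_mul_zpow_eq_sum hP, Finset.sum_apply]
    rfl
  rw [e]
  exact Submodule.sum_mem _ fun i hi =>
    Submodule.smul_mem _ _ (h i (Finset.mem_range.1 hi))

/-- This is the extension step: a shifted polynomial and all but one of its monomials being
integrated exactly, so is the remaining one. -/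
theorem mon_mem_of_eval_mul_zpow_mem {P : ℂ[X]} {N i₀ : ℕ} (hP : P.natDegree < N) (k : ℤ)
    (hi₀ : i₀ < N) (hc : P.coeff i₀ ≠ 0)
    (hmem : (fun z : Circle => P.eval (z : ℂ) * (z : ℂ) ^ k) ∈ R.exactSubmodule)
    (h : ∀ i : ℕ, i < N → i ≠ i₀ →
      (fun z : Circle => (z : ℂ) ^ ((i : ℤ) + k)) ∈ R.exactSubmodule) :
    (fun z : Circle => (z : ℂ) ^ ((i₀ : ℤ) + k)) ∈ R.exactSubmodule := by
  have e : (fun z : Circle => P.eval (z : ℂ) * (z : ℂ) ^ k) =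
      P.coeff i₀ • (fun z : Circle => (z : ℂ) ^ ((i₀ : ℤ) + k)) +
      ∑ i ∈ (Finset.range N).erase i₀, P.coeff i • fun z : Circle => (z : ℂ) ^ ((i : ℤ) + k) := by
    ext z
    rw [eval_mul_zpow_eq_sum hP, Pi.add_apply, Finset.sum_apply,
      ← Finset.add_sum_erase _ _ (Finset.mem_range.2 hi₀)]
    rfl
  rw [e] at hmem
  have hsum := Submodule.sum_mem R.exactSubmodule (t := (Finset.range N).erase i₀)
    (f := fun i => P.coeff i • fun z : Circle => (z : ℂ) ^ ((i : ℤ) + k))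
    fun i hi => Submodule.smul_mem _ _
      (h i (Finset.mem_range.1 (Finset.mem_of_mem_erase hi)) (Finset.ne_of_mem_erase hi))
  exact (Submodule.smul_mem_iff _ hc).1 ((Submodule.add_mem_iff_left _ hsum).1 hmem)

theorem eval_mem_of_exactOn {m : ℕ} (h : R.ExactOn (calLEven m)) {P : ℂ[X]}
    (hP : P.natDegree ≤ m) : (fun z : Circle => P.eval (z : ℂ)) ∈ R.exactSubmodule := by
  have := R.eval_mul_zpow_mem (Nat.lt_succ_of_le hP) 0
    fun i hi => R.mon_mem_of_exactOn h (by omega) (by omega)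
  simpa using this

omit [IsFiniteMeasure μ] in
theorem lagrangeLaurent_eq (p : ℕ) (s : Fin n) (z : Circle) :
    lagrangeLaurent R.node p s z = ((z : ℂ) / R.node s) ^ (-(p : ℤ)) *
      (Lagrange.basis Finset.univ (fun s => (R.node s : ℂ)) s).eval (z : ℂ) := by
  rw [lagrangeLaurent, Lagrange.basis, eval_prod]
  congr 1
  refine Finset.prod_congr rfl fun j _ => ?_
  rw [Lagrange.basisDivisor, eval_mul, eval_C, eval_sub, eval_X, eval_C, div_eq_inv_mul]

omit [IsFiniteMeasure μ] in
theorem continuous_lagrangeLaurent (p : ℕ) (s : Fin n) :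
    Continuous (lagrangeLaurent R.node p s) := by
  have e : lagrangeLaurent R.node p s = fun z : Circle => ((z : ℂ) ^ (-(p : ℤ)) *
      ((R.node s : ℂ) ^ (-(p : ℤ)))⁻¹) *
      (Lagrange.basis Finset.univ (fun s => (R.node s : ℂ)) s).eval (z : ℂ) := by
    ext z
    rw [lagrangeLaurent_eq, div_zpow, div_eq_mul_inv]
  rw [e]
  exact ((continuous_coe_zpow _).mul continuous_const).mul (continuous_eval_coe _)

omit [IsFiniteMeasure μ] in
theorem zpow_eq_sum_lagrangeLaurent {p : ℕ} {j : ℤ} (h1 : -(p : ℤ) ≤ j)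
    (h2 : j + p < n) (z : Circle) :
    (z : ℂ) ^ j = ∑ s, (R.node s : ℂ) ^ j * lagrangeLaurent R.node p s z := by
  obtain ⟨i, hi⟩ := Int.eq_ofNat_of_zero_le (by omega : 0 ≤ j + p)
  have hdeg : (X ^ i : ℂ[X]).degree < (Finset.univ : Finset (Fin n)).card := by
    rw [degree_X_pow, Finset.card_univ, Fintype.card_fin]
    exact_mod_cast (by omega : i < n)
  have h := congrArg (fun P : ℂ[X] => P.eval (z : ℂ)) (Lagrange.eq_interpolate R.injOn_node hdeg)
  simp only [Lagrange.interpolate_apply, eval_finsetSum, eval_mul, eval_C, eval_pow, eval_X] at h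
  have hj : j = i + -(p : ℤ) := by omega
  rw [hj, zpow_add₀ z.coe_ne_zero, zpow_natCast, h, Finset.sum_mul]
  refine Finset.sum_congr rfl fun s _ => ?_
  have h3 := zpow_ne_zero (-(p : ℤ)) (R.node s).coe_ne_zero
  rw [lagrangeLaurent_eq, zpow_add₀ (R.node s).coe_ne_zero, zpow_natCast, div_zpow]
  generalize (R.node s : ℂ) ^ (-(p : ℤ)) = A at h3 ⊢
  generalize (z : ℂ) ^ (-(p : ℤ)) = B
  field_simp

theorem exists_mon_mem_of_interpolatory : ∃ p : ℕ, p + 1 ≤ n ∧ ∀ j : ℤ, -(p : ℤ) ≤ j →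
    j + p < n → (fun z : Circle => (z : ℂ) ^ j) ∈ R.exactSubmodule := by
  obtain ⟨p, hp, hw⟩ := R.interpolatory
  refine ⟨p, hp, fun j h1 h2 => ⟨continuous_coe_zpow j, ?_⟩⟩
  rw [integral_congr_ae (Filter.Eventually.of_forall (R.zpow_eq_sum_lagrangeLaurent h1 h2)),
    integral_finsetSum _ fun s _ =>
    (integrable_of_continuous μ (R.continuous_lagrangeLaurent p s)).const_mul _]
  refine Finset.sum_congr rfl fun s _ => ?_
  rw [integral_const_mul, hw s, mul_comm]

theorem nodal_mul_zpow_mem_iff (k : ℕ) :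
    (fun z : Circle => R.nodal.eval (z : ℂ) * (z : ℂ) ^ (-(k : ℤ))) ∈ R.exactSubmodule ↔
      ip μ R.nodal (X ^ k) = 0 := by
  have e : ip μ R.nodal (X ^ k) = ∫ z : Circle, R.nodal.eval (z : ℂ) * (z : ℂ) ^ (-(k : ℤ)) ∂μ := by
    unfold ip
    simp only [eval_pow, eval_X, map_pow, conj_coe, zpow_neg, zpow_natCast, inv_pow]
  rw [mem_exactSubmodule, R.apply_nodal_mul, e]
  exact and_iff_right ((continuous_eval_coe _).mul (continuous_coe_zpow _))

end Exact

/-! ### Szegő formulas and paraorthogonality -/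

section Szego

variable {μ : Measure Circle} [IsFiniteMeasure μ] {m : ℕ} (R : Rule μ (m + 1))

theorem orthogonal_of_exactOn (h : R.ExactOn (calLEven m)) {k : ℕ} (h1 : 1 ≤ k) (h2 : k ≤ m) :
    ip μ R.nodal (X ^ k) = 0 := by
  rw [← nodal_mul_zpow_mem_iff]
  exact R.eval_mul_zpow_mem (N := m + 2) (by rw [natDegree_nodal]; omega) _
    fun i hi => R.mon_mem_of_exactOn h (by omega) (by omega)

theorem calLEven_le_of_orthogonal (h : ∀ k, 1 ≤ k → k ≤ m → ip μ R.nodal (X ^ k) = 0) :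
    calLEven m ≤ R.exactSubmodule := by
  have hlt : R.nodal.natDegree < m + 2 := by rw [natDegree_nodal]; omega
  have hlead : R.nodal.coeff (m + 1) ≠ 0 := by
    have := R.nodal_monic.coeff_natDegree
    rw [natDegree_nodal] at this
    rw [this]
    exact one_ne_zero
  obtain ⟨p, hp, hmem⟩ := R.exists_mon_mem_of_interpolatory
  -- The rule starts with the window of exponents `-p, …, m-p`. The relations `k = p, …, 1` each add
  -- one exponent at the top, through the leading coefficient of the nodal polynomial.
  have hup : ∀ t : ℕ, t ≤ p → ∀ j : ℤ, -(p : ℤ) ≤ j → j ≤ m - p + t →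
      (fun z : Circle => (z : ℂ) ^ j) ∈ R.exactSubmodule := by
    intro t
    induction t with
    | zero => exact fun _ j h1 h2 => hmem j h1 (by push_cast at h2 ⊢; omega)
    | succ t ih =>
      intro ht j h1 h2
      by_cases hj : j ≤ m - p + t
      · exact ih (by omega) j h1 hj
      · have := R.mon_mem_of_eval_mul_zpow_mem hlt (-((p - t : ℕ) : ℤ)) (by omega : m + 1 < m + 2)
          hlead ((R.nodal_mul_zpow_mem_iff (p - t)).2 (h _ (by omega) (by omega)))
          fun i hi hne => ih (by omega) _ (by omega) (by omega)
        have e : ((m + 1 : ℕ) : ℤ) + -((p - t : ℕ) : ℤ) = j := by push_cast at h2; omega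
        rwa [e] at this
  -- The relations `k = p+1, …, m` then add one exponent each at the bottom, through the nonzero
  -- constant coefficient.
  have hdown : ∀ t : ℕ, p + t ≤ m → ∀ j : ℤ, -(p : ℤ) - t ≤ j → j ≤ m →
      (fun z : Circle => (z : ℂ) ^ j) ∈ R.exactSubmodule := by
    intro t
    induction t with
    | zero => exact fun _ j h1 h2 => hup p le_rfl j (by simpa using h1) (by omega)
    | succ t ih =>
      intro ht j h1 h2
      by_cases hj : -(p : ℤ) - t ≤ j
      · exact ih (by omega) j hj h2
      · have := R.mon_mem_of_eval_mul_zpow_mem hlt (-((p + t + 1 : ℕ) : ℤ)) (by omega : 0 < m + 2)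
          R.nodal_coeff_zero_ne_zero
          ((R.nodal_mul_zpow_mem_iff (p + t + 1)).2 (h _ (by omega) (by omega)))
          fun i hi hne => ih (by omega) _ (by omega) (by omega)
        have e : ((0 : ℕ) : ℤ) + -((p + t + 1 : ℕ) : ℤ) = j := by push_cast at h1 ⊢; omega
        rwa [e] at this
  exact R.calLEven_le_of_mon_mem fun j h1 h2 => hdown (m - p) (by omega) j (by omega) h2

variable (hμ : μ.support.Infinite)

include hμ in
-- On the circle `|ℓ_s|²` equals `ℓ_s ℓ_s^* z^{-m}`, an element of `𝓛_{2m}`; it is 1 at `z_s` and 0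
-- at the other nodes, so the weight is `‖ℓ_s‖²`.
theorem positive_of_exactOn (h : R.ExactOn (calLEven m)) : R.Positive := by
  intro s
  set ℓ := Lagrange.basis Finset.univ (fun s => (R.node s : ℂ)) s with hℓ
  have hℓ0 : ℓ ≠ 0 := Lagrange.basis_ne_zero R.injOn_node (Finset.mem_univ s)
  have hdeg : ℓ.natDegree ≤ m := by
    rw [hℓ, Lagrange.natDegree_basis R.injOn_node (Finset.mem_univ s), Finset.card_univ,
      Fintype.card_fin, Nat.add_sub_cancel]
  refine ⟨_, integral_norm_sq_pos hμ hℓ0, ?_⟩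
  rw [← ip_self]
  have hPmem : (fun z : Circle => (ℓ * rev m ℓ).eval (z : ℂ) * (z : ℂ) ^ (-(m : ℤ))) ∈
      R.exactSubmodule := by
    refine R.eval_mul_zpow_mem (N := 2 * m + 1) ?_ _
      fun i hi => R.mon_mem_of_exactOn h (by omega) (by omega)
    have := natDegree_mul_le (p := ℓ) (q := rev m ℓ)
    have := natDegree_rev_le hdeg
    omega
  have e : (fun z : Circle => (ℓ * rev m ℓ).eval (z : ℂ) * (z : ℂ) ^ (-(m : ℤ))) =
      fun z : Circle => ℓ.eval (z : ℂ) * (starRingEnd ℂ) (ℓ.eval (z : ℂ)) := by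
    ext z
    have hz := pow_ne_zero m z.coe_ne_zero
    rw [eval_mul, eval_rev hdeg, zpow_neg, zpow_natCast]
    field_simp
  rw [e] at hPmem
  rw [ip, hPmem.2, apply, Finset.sum_eq_single s]
  · have h1 : ℓ.eval (R.node s : ℂ) = 1 :=
      Lagrange.eval_basis_self R.injOn_node (Finset.mem_univ s)
    rw [h1, map_one, mul_one, mul_one]
  · intro j _ hj
    have h1 : ℓ.eval (R.node j : ℂ) = 0 :=
      Lagrange.eval_basis_of_ne (v := fun s => (R.node s : ℂ)) hj.symm (Finset.mem_univ j)
    rw [h1, zero_mul, mul_zero]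
  · simp

include hμ in
theorem isSzego_iff_exists_isQPOPUC :
    R.IsSzego ↔ ∃ τ, IsQPOPUC μ (m + 1) 0 τ R.nodal := by
  constructor
  · rintro ⟨-, h⟩
    exact R.exists_isQPOPUC_of_orthogonal fun k h1 h2 => R.orthogonal_of_exactOn h h1 h2
  · rintro ⟨τ, h⟩
    have hex : R.ExactOn (calLEven m) := R.exactOn_of_le
      (R.calLEven_le_of_orthogonal fun k h1 h2 => h.orthogonal k (by omega) (by omega))
    exact ⟨R.positive_of_exactOn hμ hex, hex⟩

include hμ in
theorem nodal_eq_popuc {τ : Circle} (h : IsQPOPUC μ (m + 1) 0 τ R.nodal) :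
    R.nodal = popuc μ m τ := by
  have h0 : R.nodal.coeff 0 = τ := by
    have hlead := R.nodal_monic.coeff_natDegree
    rw [natDegree_nodal] at hlead
    rw [h.invariant, coeff_C_mul, coeff_rev (Nat.zero_le _), Nat.sub_zero, hlead]
    simp
  have := eq_X_mul_rho_add hμ R.nodal_monic R.natDegree_nodal
    fun k h1 h2 => h.orthogonal k (by omega) (by omega)
  rwa [h0] at this

theorem isQPOPUC_of_nodal_eq_popuc (hμ : μ.support.Infinite) {τ : Circle}
    (h : R.nodal = popuc μ m τ) : IsQPOPUC μ (m + 1) 0 τ R.nodal where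
  degree_eq := by rw [degree_eq_natDegree R.nodal_monic.ne_zero, R.natDegree_nodal]
  invariant := by
    have := R.nodal_eq_C_mul_rev
    rwa [show R.nodal.coeff 0 = τ by rw [h, popuc_coeff_zero]] at this
  orthogonal k h1 h2 := by
    rw [h]
    exact ip_popuc_X_pow hμ τ (by omega) (by omega)

include hμ in
-- Both rules have the same node set, possibly in different order, so they are compared as
-- functionals: each agrees on `f` with the integral of the polynomial interpolating `f` there.
theorem apply_eq_apply {R R' : Rule μ (m + 1)} {τ : Circle}
    (h : IsQPOPUC μ (m + 1) 0 τ R.nodal) (h' : IsQPOPUC μ (m + 1) 0 τ R'.nodal) :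
    R.apply = R'.apply := by
  have hnodal : R'.nodal = R.nodal := (R'.nodal_eq_popuc hμ h').trans (R.nodal_eq_popuc hμ h).symm
  have hex := ((R.isSzego_iff_exists_isQPOPUC hμ).2 ⟨τ, h⟩).2
  have hex' := ((R'.isSzego_iff_exists_isQPOPUC hμ).2 ⟨τ, h'⟩).2
  ext f
  set q := Lagrange.interpolate Finset.univ (fun s => (R.node s : ℂ)) (fun s => f (R.node s))
    with hq
  have hdeg : q.natDegree ≤ m := by
    have := Lagrange.degree_interpolate_lt (fun s => f (R.node s)) R.injOn_node
    rw [Finset.card_univ, Fintype.card_fin] at this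
    exact natDegree_le_of_degree_lt_succ this
  have hval : ∀ s, q.eval (R.node s : ℂ) = f (R.node s) := fun s =>
    Lagrange.eval_interpolate_at_node _ R.injOn_node (Finset.mem_univ s)
  have hval' : ∀ s, q.eval (R'.node s : ℂ) = f (R'.node s) := by
    intro s
    have h1 := (R'.eval_nodal_eq_zero_iff (R'.node s)).2 ⟨s, rfl⟩
    rw [hnodal, R.eval_nodal_eq_zero_iff] at h1
    obtain ⟨t, ht⟩ := h1
    rw [← ht, hval]
  have e := (R.eval_mem_of_exactOn hex hdeg).2
  have e' := (R'.eval_mem_of_exactOn hex' hdeg).2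
  calc R.apply f = R.apply fun z => q.eval (z : ℂ) :=
        Finset.sum_congr rfl fun s _ => congrArg _ (hval s).symm
    _ = R'.apply fun z => q.eval (z : ℂ) := e.symm.trans e'
    _ = R'.apply f := Finset.sum_congr rfl fun s _ => congrArg _ (hval' s)

omit [IsFiniteMeasure μ] in
theorem apply_conj {R : Rule μ (m + 1)} (h : R.Positive) (f : Circle → ℂ) :
    R.apply (fun z => (starRingEnd ℂ) (f z)) = (starRingEnd ℂ) (R.apply f) := by
  rw [apply, apply, map_sum]
  refine Finset.sum_congr rfl fun s _ => ?_
  obtain ⟨r, _, hr⟩ := h s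
  rw [map_mul, hr, conj_ofReal]

include hμ in
/-- The error of the formula at `z ^ n`. -/
theorem integral_pow_sub_apply {τ : Circle} (h : IsQPOPUC μ (m + 1) 0 τ R.nodal) :
    (∫ z : Circle, (z : ℂ) ^ (m + 1) ∂μ) - R.apply (fun z => (z : ℂ) ^ (m + 1)) =
      (τ - delta μ (m + 1)) * ip μ (rho μ m) (rho μ m) := by
  have hex := ((R.isSzego_iff_exists_isQPOPUC hμ).2 ⟨τ, h⟩).2
  -- The lower-degree part of the nodal polynomial is integrated exactly and equals `-z^{m+1}` at
  -- the nodes, so the error at `z^{m+1}` is `⟨W, 1⟩`.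
  have hdeg : (R.nodal - X ^ (m + 1)).natDegree ≤ m := by
    have : (R.nodal - X ^ (m + 1)).degree < R.nodal.degree := by
      refine degree_sub_lt_left ?_ R.nodal_monic.ne_zero ?_
      · rw [degree_X_pow, h.degree_eq]
      · rw [R.nodal_monic.leadingCoeff, leadingCoeff_X_pow]
    rw [h.degree_eq] at this
    exact natDegree_le_of_degree_lt_succ this
  have e := (R.eval_mem_of_exactOn hex hdeg).2
  have e1 : ∫ z : Circle, (R.nodal - X ^ (m + 1)).eval (z : ℂ) ∂μ =
      ip μ R.nodal 1 - ∫ z : Circle, (z : ℂ) ^ (m + 1) ∂μ := by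
    rw [ip, ← integral_sub]
    · simp
    · exact integrable_of_continuous μ (continuous_ip_integrand _ _)
    · exact integrable_of_continuous μ (by simpa using continuous_eval_coe (X ^ (m + 1)))
  have e2 : R.apply (fun z => (R.nodal - X ^ (m + 1)).eval (z : ℂ)) =
      -R.apply fun z => (z : ℂ) ^ (m + 1) := by
    rw [apply, apply, ← Finset.sum_neg_distrib]
    refine Finset.sum_congr rfl fun s _ => ?_
    rw [eval_sub, (R.eval_nodal_eq_zero_iff (R.node s)).2 ⟨s, rfl⟩, eval_pow, eval_X]
    ring
  rw [e1, e2, R.nodal_eq_popuc hμ h, ip_popuc_one hμ] at e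
  linear_combination -e

include hμ in
theorem exactOn_calLOdd_iff {τ : Circle} (h : IsQPOPUC μ (m + 1) 0 τ R.nodal) (ω : Circle) :
    R.ExactOn (calLOdd m ω) ↔ (ω : ℂ) = τ * mobius (-delta μ (m + 1)) τ := by
  obtain ⟨hpos, hex⟩ := (R.isSzego_iff_exists_isQPOPUC hμ).2 ⟨τ, h⟩
  have herr := R.integral_pow_sub_apply hμ h
  set f : Circle → ℂ := fun z => (z : ℂ) ^ (m + 1) with hf
  set g : Circle → ℂ := fun z => (z : ℂ) ^ (m + 1) - (ω : ℂ) / (z : ℂ) ^ (m + 1) with hg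
  set δ := delta μ (m + 1) with hδ
  have hfc : Continuous f := by simpa using continuous_eval_coe (X ^ (m + 1))
  have hgf : g = fun z => f z - ω * (starRingEnd ℂ) (f z) := by
    ext z
    simp only [hg, hf, map_pow, conj_coe, div_eq_mul_inv, inv_pow]
  have hcf : Continuous fun z => (starRingEnd ℂ) (f z) := continuous_conj.comp hfc
  have hgc : Continuous g := by
    rw [hgf]
    exact hfc.sub (continuous_const.mul hcf)
  have hle : R.ExactOn (calLOdd m ω) ↔ g ∈ R.exactSubmodule := by
    constructor
    · intro H
      exact ⟨hgc, H g (Submodule.mem_sup_right (Submodule.subset_span rfl))⟩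
    · intro H
      refine R.exactOn_of_le (sup_le ?_ ((Submodule.span_singleton_le_iff_mem _ _).2 H))
      exact R.calLEven_le_of_mon_mem fun j h1 h2 => R.mon_mem_of_exactOn hex h1 h2
  have hI : ∫ z, g z ∂μ = (∫ z, f z ∂μ) - ω * (starRingEnd ℂ) (∫ z, f z ∂μ) := by
    rw [hgf, integral_sub (integrable_of_continuous μ hfc)
      ((integrable_of_continuous μ hcf).const_mul _), integral_const_mul, integral_conj]
  -- Real weights let the rule commute with conjugation, so its error at `g` is `E - ω conj E`, with
  -- `E` its error at `f`.
  have hA : R.apply g = R.apply f - ω * (starRingEnd ℂ) (R.apply f) := by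
    rw [← apply_conj hpos, hgf]
    simp only [apply, mul_sub, Finset.sum_sub_distrib, Finset.mul_sum]
    congr 1
    exact Finset.sum_congr rfl fun s _ => by ring
  have hh : ip μ (rho μ m) (rho μ m) ≠ 0 := (ip_self_eq_zero hμ).not.2 (rho_monic μ m).ne_zero
  have herr' := congrArg (starRingEnd ℂ) herr
  rw [map_sub, map_mul, map_sub, conj_ip, conj_coe] at herr'
  have hτ := τ.coe_ne_zero
  have hden : 1 + (starRingEnd ℂ) (-δ) * τ ≠ 0 := by
    intro h0
    refine delta_ne_coe hμ m τ ?_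
    have h1 : (starRingEnd ℂ) δ = (τ : ℂ)⁻¹ := by
      rw [map_neg] at h0
      field_simp
      linear_combination -h0
    rw [← conj_coe] at h1
    exact (starRingEnd ℂ).injective h1
  have hττ := mul_inv_cancel₀ hτ
  rw [hle, mem_exactSubmodule, and_iff_right hgc, hI, hA, mobius, ← mul_div_assoc,
    eq_div_iff hden, map_neg]
  constructor
  · intro H
    -- Multiplying `E = ω conj E` by `τ` and using `τ conj τ = 1` clears the conjugate of `τ`.
    have h1 : ip μ (rho μ m) (rho μ m) *
        (ω * (1 + -(starRingEnd ℂ) δ * τ) - τ * (τ + -δ)) = 0 := by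
      linear_combination -(τ : ℂ) * H - τ * ω * herr' + τ * herr -
        ip μ (rho μ m) (rho μ m) * ω * hττ
    exact sub_eq_zero.1 ((mul_eq_zero.1 h1).resolve_left hh)
  · intro H
    refine mul_left_cancel₀ hτ ?_
    linear_combination -ip μ (rho μ m) (rho μ m) * H - τ * ω * herr' + τ * herr -
      ip μ (rho μ m) (rho μ m) * ω * hττ

end Szego

end Rule

/-! ### Admissible values of the invariance parameter -/

section Admissible

variable {μ : Measure Circle} [IsFiniteMeasure μ] {a b : Circle}
  (hμ : μ.support = {z : Circle | (z : ℂ) ∈ closedArc a b}) {m : ℕ}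
include hμ

theorem Rule.forall_node_iff {R : Rule μ (m + 1)} {τ : Circle}
    (h : IsQPOPUC μ (m + 1) 0 τ R.nodal) (A : Set ℂ) :
    (∀ s, (R.node s : ℂ) ∈ A) ↔
      ∀ z : Circle, (popuc μ m τ).eval (z : ℂ) = 0 → (z : ℂ) ∈ A := by
  rw [← R.nodal_eq_popuc (infinite_support hμ) h]
  simp only [R.eval_nodal_eq_zero_iff]
  constructor
  · rintro H z ⟨s, rfl⟩
    exact H s
  · exact fun H s => H _ ⟨s, rfl⟩

theorem Rule.neg_mem_closedArc {R : Rule μ (m + 1)} {τ : Circle}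
    (h : IsQPOPUC μ (m + 1) 0 τ R.nodal) :
    -(τ : ℂ) ∈ closedArc (blaschke μ (m + 1) a) (blaschke μ (m + 1) b) := by
  rw [← forall_root_mem_closedArc_iff hμ, ← Rule.forall_node_iff hμ h]
  intro s
  have := R.node_mem s
  rwa [hμ] at this

theorem exists_rule {τ : Circle}
    (h : -(τ : ℂ) ∈ closedArc (blaschke μ (m + 1) a) (blaschke μ (m + 1) b)) :
    ∃ R : Rule μ (m + 1), IsQPOPUC μ (m + 1) 0 τ R.nodal := by
  have hinf := infinite_support hμ
  obtain ⟨Ψ, hΨ⟩ := exists_isPhase_blaschke hinf m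
  obtain ⟨node, hinj, hnode⟩ := hΨ.exists_nodes (-τ)
  have hroot : ∀ s, (popuc μ m τ).eval (node s : ℂ) = 0 := fun s =>
    (eval_popuc_eq_zero_iff hinf m τ (node s)).2 (hnode s)
  -- The choice `p = 0` costs nothing: orthogonality gives exactness in `𝓛_{2m}` whatever the
  -- initial window.
  let R : Rule μ (m + 1) :=
    { node := node
      weight := fun s => ∫ z, lagrangeLaurent node 0 s z ∂μ
      node_injective := hinj
      node_mem := fun s => by
        rw [hμ]
        exact (forall_root_mem_closedArc_iff hμ m τ).2 h _ (hroot s)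
      interpolatory := ⟨0, by omega, fun _ => rfl⟩ }
  refine ⟨R, R.isQPOPUC_of_nodal_eq_popuc hinf ?_⟩
  obtain ⟨hmon, hdeg⟩ := popuc_monic_natDegree μ m τ
  refine eq_of_degree_sub_lt_of_eval_index_eq _ R.injOn_node ?_ fun s _ => ?_
  · have h1 : R.nodal.degree = (m + 1 : ℕ) := by
      rw [degree_eq_natDegree R.nodal_monic.ne_zero, R.natDegree_nodal]
    have h2 : (popuc μ m τ).degree = (m + 1 : ℕ) := by
      rw [degree_eq_natDegree hmon.ne_zero, hdeg]
    rw [Finset.card_univ, Fintype.card_fin, ← h1]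
    refine degree_sub_lt_left (h1.trans h2.symm) R.nodal_monic.ne_zero ?_
    rw [R.nodal_monic.leadingCoeff, hmon.leadingCoeff]
  · rw [(R.eval_nodal_eq_zero_iff (R.node s)).2 ⟨s, rfl⟩]
    exact (hroot s).symm

theorem Rule.neg_eq_blaschke_iff {R : Rule μ (m + 1)} {τ : Circle}
    (h : IsQPOPUC μ (m + 1) 0 τ R.nodal) (α : Circle) :
    -(τ : ℂ) = blaschke μ (m + 1) α ↔ ∃ s, R.node s = α := by
  have hinf := infinite_support hμ
  rw [← R.eval_nodal_eq_zero_iff, R.nodal_eq_popuc hinf h, eval_popuc_eq_zero_iff hinf, eq_comm,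
    Circle.coe_neg]

end Admissible

end SzegoQuad

/-! ### Assembly of the theorem -/

theorem theorem4p2 (μ : Measure Circle) [IsFiniteMeasure μ] (a b : Circle)
    (hμ : μ.support = {z : Circle | (z : ℂ) ∈ closedArc a b}) (n : ℕ) (hn : 2 ≤ n) :
    -- Szegő formulas exact in the space of dimension `2n`
    (∀ (R : Rule μ n) (ω : Circle),
      (R.IsSzego ∧ R.ExactOn (calLOdd (n - 1) ω)) ↔
        ∃ τ : Circle, IsQPOPUC μ n 0 τ R.nodal ∧
          -(τ : ℂ) ∈ closedArc (blaschke μ n a) (blaschke μ n b) ∧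
          (ω : ℂ) = τ * mobius (-delta μ n) τ) ∧
    -- every admissible `τ`, and no other, occurs; the formula is unique
    (∀ τ : Circle,
      (∃ R : Rule μ n, R.IsSzego ∧ IsQPOPUC μ n 0 τ R.nodal) ↔
        -(τ : ℂ) ∈ closedArc (blaschke μ n a) (blaschke μ n b)) ∧
    (∀ (R R' : Rule μ n) (τ : Circle), IsQPOPUC μ n 0 τ R.nodal → IsQPOPUC μ n 0 τ R'.nodal →
      R.apply = R'.apply) ∧
    -- the nodes all lie in the open arc exactly for `-τ` in the open arc
    (∀ (R : Rule μ n) (τ : Circle), IsQPOPUC μ n 0 τ R.nodal →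
      ((∀ s, (R.node s : ℂ) ∈ openArc a b) ↔
        -(τ : ℂ) ∈ openArc (blaschke μ n a) (blaschke μ n b))) ∧
    -- Szegő-Radau formulas with a prefixed node in the open arc
    (∀ α : Circle, (α : ℂ) ∈ openArc a b →
      (∀ R : Rule μ n, R.IsSzegoRadau α ↔
        ∃ τ : Circle, IsQPOPUC μ n 0 τ R.nodal ∧
          -(τ : ℂ) = α * (rho μ (n - 1)).eval (α : ℂ) /
            (rev (n - 1) (rho μ (n - 1))).eval (α : ℂ) ∧
          -(τ : ℂ) ∈ closedArc (blaschke μ n a) (blaschke μ n b)) ∧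
      (∀ R R' : Rule μ n, R.IsSzegoRadau α → R'.IsSzegoRadau α → R.apply = R'.apply) ∧
      ((∃ R : Rule μ n, R.IsSzegoRadau α) ↔
        blaschke μ n α ∈ closedArc (blaschke μ n a) (blaschke μ n b)) ∧
      (∀ (R : Rule μ n) (τ ω : Circle), IsQPOPUC μ n 0 τ R.nodal →
        -(τ : ℂ) = α * (rho μ (n - 1)).eval (α : ℂ) /
            (rev (n - 1) (rho μ (n - 1))).eval (α : ℂ) →
        (ω : ℂ) = τ * mobius (-delta μ n) τ →
        R.IsSzegoRadau α ∧ R.ExactOn (calLOdd (n - 1) ω))) := by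
  obtain ⟨m, rfl⟩ : ∃ m, n = m + 1 := ⟨n - 1, by omega⟩
  have hinf := infinite_support hμ
  simp only [Nat.add_sub_cancel]
  have hF : ∀ α : Circle, (α : ℂ) * (rho μ m).eval (α : ℂ) / (rev m (rho μ m)).eval (α : ℂ) =
      blaschke μ (m + 1) α := fun α => rfl
  -- The arc condition is absent here because it follows from the nodes of a rule lying in the
  -- support.
  have hSR : ∀ (α : Circle) (R : Rule μ (m + 1)), R.IsSzegoRadau α ↔
      ∃ τ : Circle, IsQPOPUC μ (m + 1) 0 τ R.nodal ∧ -(τ : ℂ) = blaschke μ (m + 1) α := by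
    intro α R
    constructor
    · rintro ⟨hS, hα⟩
      obtain ⟨τ, h⟩ := (R.isSzego_iff_exists_isQPOPUC hinf).1 hS
      exact ⟨τ, h, (Rule.neg_eq_blaschke_iff hμ h α).2 hα⟩
    · rintro ⟨τ, h, hα⟩
      exact ⟨(R.isSzego_iff_exists_isQPOPUC hinf).2 ⟨τ, h⟩,
        (Rule.neg_eq_blaschke_iff hμ h α).1 hα⟩
  refine ⟨fun R ω => ⟨?_, ?_⟩, fun τ => ⟨?_, ?_⟩, fun R R' τ h h' => Rule.apply_eq_apply hinf h h',
    fun R τ h => ?_, fun α _ => ⟨fun R => ?_, fun R R' h h' => ?_, ⟨?_, fun h => ?_⟩,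
      fun R τ ω h hα hω => ?_⟩⟩
  · rintro ⟨hS, hω⟩
    obtain ⟨τ, h⟩ := (R.isSzego_iff_exists_isQPOPUC hinf).1 hS
    exact ⟨τ, h, Rule.neg_mem_closedArc hμ h, (R.exactOn_calLOdd_iff hinf h ω).1 hω⟩
  · rintro ⟨τ, h, _, hω⟩
    exact ⟨(R.isSzego_iff_exists_isQPOPUC hinf).2 ⟨τ, h⟩, (R.exactOn_calLOdd_iff hinf h ω).2 hω⟩
  · rintro ⟨R, _, h⟩
    exact Rule.neg_mem_closedArc hμ h
  · intro hτ
    obtain ⟨R, h⟩ := exists_rule hμ hτ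
    exact ⟨R, (R.isSzego_iff_exists_isQPOPUC hinf).2 ⟨τ, h⟩, h⟩
  · rw [← forall_root_mem_openArc_iff hμ]
    exact Rule.forall_node_iff hμ h _
  · rw [hSR, hF]
    exact ⟨fun ⟨τ, h, hα⟩ => ⟨τ, h, hα, Rule.neg_mem_closedArc hμ h⟩,
      fun ⟨τ, h, hα, _⟩ => ⟨τ, h, hα⟩⟩
  · obtain ⟨τ, hτ, hα⟩ := (hSR α R).1 h
    obtain ⟨τ', hτ', hα'⟩ := (hSR α R').1 h'
    obtain rfl : τ = τ' := Circle.ext (neg_injective (hα.trans hα'.symm))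
    exact Rule.apply_eq_apply hinf hτ hτ'
  · rintro ⟨R, h⟩
    obtain ⟨τ, hτ, hα⟩ := (hSR α R).1 h
    rw [← hα]
    exact Rule.neg_mem_closedArc hμ hτ
  · obtain ⟨θ, rfl⟩ : ∃ θ, Circle.exp θ = α := ⟨_, Circle.exp_arg α⟩
    obtain ⟨Ψ, hΨ⟩ := exists_isPhase_blaschke hinf m
    -- The phase provides `F_n(α)` as a point of the circle, so that its negative can serve as `τ`.
    have hτ : -((-Circle.exp (Ψ θ) : Circle) : ℂ) = blaschke μ (m + 1) (Circle.exp θ) := by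
      rw [hΨ.apply_exp, Circle.coe_neg, neg_neg]
    rw [← hτ] at h
    obtain ⟨R, hR⟩ := exists_rule hμ h
    exact ⟨R, (hSR _ R).2 ⟨_, hR, hτ⟩⟩
  · exact ⟨(hSR α R).2 ⟨τ, h, hα⟩, (R.exactOn_calLOdd_iff hinf h ω).2 hω⟩
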